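/- **Setting.** Let $2\le r\le 9$, $n\ge 0$ and $\varepsilon>0$. On a uniform mesh with cells $I_j=[x_{j-1/2},x_{j+1/2}]$ of width $\Delta x$ and centres $x_j$, let $\bar u_j=\frac1{\Delta x}\int_{I_j}u$ be the cell averages of a function $u$. For $s=0,\dots,r-1$ let $p_s$ be the polynomial of degree at most $r-1$ whose averages over the $r$ cells $I_{j+s-r+1},\dots,I_{j+s}$ are the $\bar u$'s, let $u^{s,-}_{j+1/2}=p_s(x_{j+1/2})$, and put $$\beta_s=\sum_{l=1}^{r-1}\Delta x^{2l-1}\int_{I_j}\big(p_s^{(l)}(x)\big)^2dx,\qquad d_s=\binom rs\binom{r-1}s\Big/\binom{2r-1}{r-1},\qquad \alpha_s^{\mathrm{M}(0)}=\frac{d_s}{(\varepsilon+\beta_s)^2},$$ where $\beta_s$ are the Jiang–Shu smoothness indicators and $d_s$ the optimal weights. For $m\ge0$ set $\omega_s^{\mathrm{M}(m)}=\alpha_s^{\mathrm{M}(m)}/\sum_{l=0}^{r-1}\alpha_l^{\mathrm{M}(m)}$, and for $m\ge 1$ set $$\alpha_s^{\mathrm{M}(m)}=g_s\big(\omega_s^{\mathrm{M}(m-1)}\big),\qquad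 g_s(\omega)=\frac{\omega\,(d_s+d_s^2-3d_s\omega+\omega^2)}{d_s^2+(1-2d_s)\omega}.$$ The $(2r-1)$th-order WENO-M scheme with $n$ mappings uses $u^-_{j+1/2}=\sum_s\omega_s^{\mathrm{M}(n)}u^{s,-}_{j+1/2}$, the mirror-image reconstruction $u^+_{j+1/2}$, the flux $\hat f_{j+1/2}=\frac12\big[f(u^-_{j+1/2})+f(u^+_{j+1/2})-a\,(u^+_{j+1/2}-u^-_{j+1/2})\big]$ with a constant $a$, and the semi-discrete operator $\mathcal L_j=-\frac1{\Delta x}(\hat f_{j+1/2}-\hat f_{j-1/2})$ for $u_t+f(u)_x=0$. **Statement.** Let $0\le n_{\mathrm{cp}}\le r-1$, and let $u$ be smooth near a point $x_c$ with $u'(x_c)=\dots=u^{(n_{\mathrm{cp}})}(x_c)=0$ and $u^{(n_{\mathrm{cp}}+1)}(x_c)\ne0$ (so $u'(x_c)\neq 0$ if $n_{\mathrm{cp}}=0$). Let $K$ be a constant. As $\Delta x\to0$, for all cells $I_j$ with $|x_j-x_c|\le K\Delta x$ (in particular, with $K=\frac12$, for the cells containing $x_c$), uniformly in the position of the mesh,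 in $j$ and in $\varepsilon>0$: 1. for $s=0,\dots,r-1$, $$\omega_s^{\mathrm{M}(n)}-d_s=O\big(\Delta x^{\,3^n(r-1-n_{\mathrm{cp}})}\big);$$ 2. the scheme has rate of convergence $r_{\mathrm c}$ (in the sense of order of accuracy): for every flux $f$ smooth near $u(x_c)$ and every constant $a$, $$\mathcal L_j+\frac{f(u(x_{j+1/2}))-f(u(x_{j-1/2}))}{\Delta x}=O(\Delta x^{\,r_{\mathrm c}}),\qquad r_{\mathrm c}=\begin{cases}2r-1,& n_{\mathrm{cp}}\le\big\lfloor\frac{3^n-1}{3^n}r-1\big\rfloor,\\ (3^n+1)(r-1)-3^n n_{\mathrm{cp}},&\text{otherwise.}\end{cases}$$ -/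

import Mathlib

open Polynomial
open scoped ContDiff

noncomputable section

namespace WENO

/-- Cell average `(1/Δx) ∫ u` over the cell with centre `x` and width `h`. -/
def cellAverage (u : ℝ → ℝ) (h x : ℝ) : ℝ :=
  (1 / h) * ∫ ξ in (x - h / 2)..(x + h / 2), u ξ

/-- Exact cell averages on the uniform mesh with centres `x_j = x₀ + j h`. -/
def meshAverages (u : ℝ → ℝ) (h x₀ : ℝ) (j : ℤ) : ℝ :=
  cellAverage u h (x₀ + j * h)

/-- Values at the cell interfaces of a primitive of the piecewise constant data on the substencil
`{s - r + 1, …, s}`; here `v k` is the average on the `k`-th cell to the right of the current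
cell. -/
def primitiveValue (r s : ℕ) (v : ℤ → ℝ) (i : ℕ) : ℝ :=
  ∑ k ∈ Finset.range i, v ((s : ℤ) - (r : ℤ) + 1 + (k : ℤ))

/-- The reconstruction polynomial of degree at most `r - 1` having the averages `v k` on the `r`
cells `k = s - r + 1, …, s`, in the variable `y = (x - x_j) / Δx` (so that cell `k` is
`[k - 1/2, k + 1/2]`): the derivative of the polynomial that interpolates the primitive at the
`r + 1` interfaces of the substencil. -/
def reconPoly (r s : ℕ) (v : ℤ → ℝ) : ℝ[X] :=
  derivative (Lagrange.interpolate (Finset.range (r + 1))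
    (fun i : ℕ => (s : ℝ) - (r : ℝ) + 1 / 2 + (i : ℝ)) (primitiveValue r s v))

/-- The substencil approximation `u^{s,-}_{j+1/2}`. -/
def subRecon (r s : ℕ) (v : ℤ → ℝ) : ℝ :=
  (reconPoly r s v).eval (1 / 2)

/-- The Jiang–Shu smoothness indicator
`β_s = ∑_{l=1}^{r-1} Δx^{2l-1} ∫_{I_j} (d^l p_s / dx^l)² dx`, written in `y = (x - x_j) / Δx`,
where the powers of `Δx` cancel. -/
def smoothness (r s : ℕ) (v : ℤ → ℝ) : ℝ :=
  ∑ l ∈ Finset.Icc 1 (r - 1),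
    ∫ y in (-(1 / 2) : ℝ)..(1 / 2), ((derivative^[l] (reconPoly r s v)).eval y) ^ 2

/-- The optimal (linear) weights `d_s` of the `(2r-1)`th-order scheme; for `r = 3` they are
`1/10, 6/10, 3/10`. -/
def optWeight (r s : ℕ) : ℝ :=
  ((r.choose s : ℝ) * ((r - 1).choose s : ℝ)) / ((2 * r - 1).choose (r - 1) : ℝ)

/-- Unnormalized WENO-JS weight `α_s = d_s / (ε + β_s)²`. -/
def alphaJS (r : ℕ) (ε : ℝ) (v : ℤ → ℝ) (s : ℕ) : ℝ :=
  optWeight r s / (ε + smoothness r s v) ^ 2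

/-- WENO-JS weight. -/
def weightJS (r : ℕ) (ε : ℝ) (v : ℤ → ℝ) (s : ℕ) : ℝ :=
  alphaJS r ε v s / ∑ l ∈ Finset.range r, alphaJS r ε v l

/-- The WENO-M mapping function with parameter `d`. -/
def mapM (d w : ℝ) : ℝ :=
  w * (d + d ^ 2 - 3 * d * w + w ^ 2) / (d ^ 2 + (1 - 2 * d) * w)

/-- One mapping step: apply `(g^M)_s` to each weight and normalize. -/
def mapStep (r : ℕ) (w : ℕ → ℝ) (s : ℕ) : ℝ :=
  mapM (optWeight r s) (w s) / ∑ l ∈ Finset.range r, mapM (optWeight r l) (w l)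

/-- The WENO-M weights with `n` times mapping; `n = 0` gives the WENO-JS weights. -/
def weightM (r : ℕ) (ε : ℝ) (v : ℤ → ℝ) : ℕ → ℕ → ℝ
  | 0 => weightJS r ε v
  | n + 1 => mapStep r (weightM r ε v n)

/-- The weights `ω_s^{M(n)}` used in `u^-_{j+1/2}`, for the mesh function `ubar`. -/
def weightMinus (r n : ℕ) (ε : ℝ) (ubar : ℤ → ℝ) (j : ℤ) (s : ℕ) : ℝ :=
  weightM r ε (fun k => ubar (j + k)) n s

/-- The left-biased WENO-M reconstruction at the right interface of the cell `0` of `v`. -/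
def recon (r n : ℕ) (ε : ℝ) (v : ℤ → ℝ) : ℝ :=
  ∑ s ∈ Finset.range r, weightM r ε v n s * subRecon r s v

/-- `u^-_{j+1/2}`. -/
def uMinus (r n : ℕ) (ε : ℝ) (ubar : ℤ → ℝ) (j : ℤ) : ℝ :=
  recon r n ε (fun k => ubar (j + k))

/-- `u^+_{j+1/2}`, the mirror image of the left-biased reconstruction about `x_{j+1/2}`. -/
def uPlus (r n : ℕ) (ε : ℝ) (ubar : ℤ → ℝ) (j : ℤ) : ℝ :=
  recon r n ε (fun k => ubar (j + 1 - k))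

/-- The Lax–Friedrichs flux with viscosity constant `a`. -/
def laxFriedrichs (f : ℝ → ℝ) (a p q : ℝ) : ℝ :=
  (1 / 2) * (f p + f q - a * (q - p))

/-- The numerical flux at `x_{j+1/2}`. -/
def numFlux (r n : ℕ) (ε : ℝ) (f : ℝ → ℝ) (a : ℝ) (ubar : ℤ → ℝ) (j : ℤ) : ℝ :=
  laxFriedrichs f a (uMinus r n ε ubar j) (uPlus r n ε ubar j)

/-- The semi-discrete finite volume operator
`𝓛(u)_j = -(1/Δx) (f̂_{j+1/2} - f̂_{j-1/2})` of the `(2r-1)`th-order WENO-M(n) scheme. -/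
def schemeOp (r n : ℕ) (ε : ℝ) (f : ℝ → ℝ) (a h : ℝ) (ubar : ℤ → ℝ) (j : ℤ) : ℝ :=
  -(1 / h) * (numFlux r n ε f a ubar j - numFlux r n ε f a ubar (j - 1))

/-- The exact rate of change `-(1/Δx) (f(u(x_{j+1/2})) - f(u(x_{j-1/2})))` of the cell average
on the cell with centre `x`, for the conservation law `u_t + f(u)_x = 0`. -/
def exactOp (f u : ℝ → ℝ) (h x : ℝ) : ℝ :=
  -(1 / h) * (f (u (x + h / 2)) - f (u (x - h / 2)))

/-- `u' = ⋯ = u^{(m)} = 0` and `u^{(m+1)} ≠ 0` at `x`; for `m = 0` this says `u' ≠ 0`. -/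
def IsCriticalPointOfOrder (u : ℝ → ℝ) (x : ℝ) (m : ℕ) : Prop :=
  (∀ k, 1 ≤ k → k ≤ m → iteratedDeriv k u x = 0) ∧ iteratedDeriv (m + 1) u x ≠ 0

/-- The rate of convergence `r_c` of the `(2r-1)`th-order WENO-M(n) scheme at a critical point of
order `m`. -/
def convRate (r n m : ℕ) : ℤ :=
  if (m : ℤ) ≤ ⌊((3 : ℝ) ^ n - 1) / 3 ^ n * (r : ℝ) - 1⌋ then 2 * (r : ℤ) - 1
  else (3 ^ n + 1) * ((r : ℤ) - 1) - 3 ^ n * (m : ℤ)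

end WENO

end

open Filter Topology Asymptotics

namespace WENO

/-! ### Optimal weights -/

/-! Write `m` for the order of the critical point and use the cell variable `y`. Every substencil
reproduces the Taylor polynomial of degree `r - 1`, so each `p_s` is that same polynomial up to
`O(h^r)`. Its `y`-derivatives are `O(h^(m+1))`, and the one of order `m + 1` is bounded below by a
multiple of `h^(m+1)`. Hence `β_s = B + O(h^(m+1+r))` with `B` independent of `s` and `B ≥ c
h^(2(m+1))`: the relative deviation is `O(h^(r-1-m))`, and a positive `ε` only diminishes it
(`isBigO_smoothness_sub`, `exists_le_taylorSmoothness`, `isBigO_weightJS_sub`). The mapping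
satisfies `g(ω) - d = (ω - d)^3 / (…)`, so each application triples the exponent (`mapM_sub`,
`isBigO_weightM_sub`). For `m = r - 1` the claim on the weights is mere boundedness.

For the rate, both families of weights sum to 1, so the reconstruction error is the error of the
linear scheme plus `∑ (ω_s - d_s) (u^s - u) = O(h^(r + 3^n (r-1-m)))`. The linear scheme is exact up
to degree `2r - 2`, by a Vandermonde identity (`linRecon_polyAvg`), and its error is `A h^(2r-1) +
O(h^(2r))` with `A` independent of the mesh position (`exists_isBigO_linRecon_sub`). Division by `h`
would cost an order, but the leading terms at the two interfaces of a cell cancel; for nonlinear `f`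
this is a second-difference estimate (`isBigO_flux_difference`). The flux difference is thus
accurate to `h^min(2r, r + 3^n (r-1-m))`, and dividing by `h` leaves `r_c`. The right-biased values
are left-biased ones for the reflected function `u(2 xc - x)`.

Uniformity is encoded in a filter on triples (width, `ε`, cell centre), along which all `O`
statements are made. -/

lemma sum_choose_mul_choose (r k : ℕ) (hr : 1 ≤ r) :
    ∑ s ∈ Finset.range r, (r - 1).choose s * (if s ≤ k then r.choose (k - s) else 0)
      = (2 * r - 1).choose k := by
  have h1 : 2 * r - 1 = (r - 1) + r := by omega
  rw [h1, Nat.add_choose_eq, Finset.Nat.sum_antidiagonal_eq_sum_range_succ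
    (fun i j => (r - 1).choose i * r.choose j)]
  have h2 : ∀ s, (r - 1).choose s * (if s ≤ k then r.choose (k - s) else 0)
      = if s ∈ Finset.range (k + 1) then (r - 1).choose s * r.choose (k - s) else 0 := by
    intro s
    simp only [Finset.mem_range, Nat.lt_succ_iff]
    split_ifs <;> simp
  simp only [h2]
  rw [Finset.sum_ite_mem]
  apply Finset.sum_subset Finset.inter_subset_right
  intro s hs hs'
  have : r ≤ s := by
    by_contra h
    exact hs' (Finset.mem_inter.2 ⟨Finset.mem_range.2 (not_le.1 h), hs⟩)
  rw [Nat.choose_eq_zero_of_lt (by omega), zero_mul]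

lemma optWeight_pos {r s : ℕ} (hs : s < r) : 0 < optWeight r s := by
  unfold optWeight
  have h1 := Nat.choose_pos hs.le
  have h2 : 0 < (r - 1).choose s := Nat.choose_pos (by omega)
  have h3 : 0 < (2 * r - 1).choose (r - 1) := Nat.choose_pos (by omega)
  positivity

/-- Vandermonde at `k = r`, after replacing `r.choose s` by `r.choose (r - s)`. -/
lemma sum_optWeight {r : ℕ} (hr : 1 ≤ r) : ∑ s ∈ Finset.range r, optWeight r s = 1 := by
  have h3 : 0 < (2 * r - 1).choose (r - 1) := Nat.choose_pos (by omega)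
  unfold optWeight
  rw [← Finset.sum_div, div_eq_one_iff_eq (by positivity)]
  have h := sum_choose_mul_choose r r hr
  rw [← Nat.choose_symm_of_eq_add (n := 2 * r - 1) (a := r) (b := r - 1) (by omega), ← h]
  push_cast
  refine Finset.sum_congr rfl fun s hs => ?_
  have hs' := (Finset.mem_range.1 hs).le
  rw [if_pos hs', Nat.choose_symm hs', mul_comm]

lemma optWeight_lt_one {r s : ℕ} (hr : 2 ≤ r) (hs : s < r) : optWeight r s < 1 := by
  rw [← sum_optWeight (by omega : 1 ≤ r)]
  obtain ⟨t, ht, hts⟩ : ∃ t < r, t ≠ s := by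
    rcases Nat.eq_zero_or_pos s with h | h
    · exact ⟨1, by omega, by omega⟩
    · exact ⟨0, by omega, by omega⟩
  exact Finset.single_lt_sum hts (Finset.mem_range.2 hs) (Finset.mem_range.2 ht)
    (optWeight_pos ht) fun k hk _ => (optWeight_pos (Finset.mem_range.1 hk)).le

/-! ### Derivatives of the Lagrange basis at a node -/

/-- The basis polynomial has a factor vanishing at `x a`; in the product rule only the term that
differentiates this factor survives. -/
lemma eval_derivative_basis_node {ι : Type*} [DecidableEq ι] (S : Finset ι) (x : ι → ℝ)
    {i a : ι} (hi : i ∈ S) (ha : a ∈ S) (hia : i ≠ a) (hx : x i ≠ x a) :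
    (derivative (Lagrange.basis S x i)).eval (x a)
      = (∏ j ∈ S.erase a, (x a - x j)) / (∏ j ∈ S.erase i, (x i - x j)) / (x a - x i) := by
  have ha' : a ∈ S.erase i := Finset.mem_erase.2 ⟨hia.symm, ha⟩
  have hi' : i ∈ S.erase a := Finset.mem_erase.2 ⟨hia, hi⟩
  have h1 : x i - x a ≠ 0 := sub_ne_zero.2 hx
  have h2 : x a - x i ≠ 0 := sub_ne_zero.2 hx.symm
  rw [Lagrange.basis, ← Finset.mul_prod_erase _ _ ha', derivative_mul, eval_add, eval_mul,
    eval_mul, Lagrange.eval_basisDivisor_right, zero_mul, add_zero,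
    ← Finset.mul_prod_erase (S.erase a) _ hi', ← Finset.mul_prod_erase (S.erase i) _ ha',
    eval_prod, Finset.erase_right_comm]
  simp only [Lagrange.basisDivisor, eval_mul, eval_C, eval_sub, eval_X, derivative_mul,
    derivative_C, derivative_sub, derivative_X, zero_mul, zero_add, sub_zero, mul_one,
    Finset.prod_mul_distrib, Finset.prod_inv_distrib]
  field_simp

lemma prod_erase_range_sub (n i : ℕ) (hi : i ≤ n) :
    ∏ j ∈ (Finset.range (n + 1)).erase i, ((i : ℝ) - j)
      = (-1) ^ (n - i) * (i.factorial * (n - i).factorial) := by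
  obtain ⟨m, rfl⟩ := Nat.exists_eq_add_of_le hi
  have h1 : (Finset.range (i + m + 1)).erase i
      = Finset.range i ∪ (Finset.range m).map (addLeftEmbedding (i + 1)) := by
    ext j
    simp only [Finset.mem_erase, Finset.mem_range, Finset.mem_union, Finset.mem_map,
      addLeftEmbedding_apply]
    constructor
    · rintro ⟨h, h'⟩
      rcases lt_or_gt_of_ne h with h | h
      · exact Or.inl h
      · exact Or.inr ⟨j - (i + 1), by omega, by omega⟩
    · rintro (h | ⟨k, hk, rfl⟩) <;> omega
  have h2 : Disjoint (Finset.range i) ((Finset.range m).map (addLeftEmbedding (i + 1))) := by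
    rw [Finset.disjoint_left]
    simp only [Finset.mem_range, Finset.mem_map, addLeftEmbedding_apply, not_exists, not_and]
    intros
    omega
  rw [h1, Finset.prod_union h2, Finset.prod_map, Nat.add_sub_cancel_left]
  have h3 : ∏ j ∈ Finset.range i, ((i : ℝ) - j) = i.factorial := by
    rw [← Finset.prod_range_reflect, ← Finset.prod_range_add_one_eq_factorial]
    push_cast
    refine Finset.prod_congr rfl fun j hj => ?_
    have := Finset.mem_range.1 hj
    rw [Nat.cast_sub (by omega), Nat.cast_sub (by omega)]
    push_cast
    ring
  have h4 : ∏ j ∈ Finset.range m, ((i : ℝ) - (addLeftEmbedding (i + 1) j : ℕ))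
      = (-1) ^ m * m.factorial := by
    rw [← Finset.prod_range_add_one_eq_factorial, ← Finset.card_range m, ← Finset.prod_const,
      Finset.card_range]
    push_cast
    rw [← Finset.prod_mul_distrib]
    refine Finset.prod_congr rfl fun j _ => ?_
    simp only [addLeftEmbedding_apply]
    push_cast
    ring
  rw [h3, h4]
  ring

lemma eval_derivative_basis_range (c : ℝ) (n a i : ℕ) (ha : a ≤ n) (hi : i ≤ n) (hia : i ≠ a) :
    (derivative (Lagrange.basis (Finset.range (n + 1)) (fun j : ℕ => c - a + j) i)).eval c
      = (-1) ^ (a + i + 1) * n.choose i / n.choose a / ((i : ℝ) - a) := by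
  have hia' : (i : ℝ) - a ≠ 0 := sub_ne_zero.2 (by exact_mod_cast hia)
  have hia'' : (a : ℝ) - i ≠ 0 := sub_ne_zero.2 (by exact_mod_cast hia.symm)
  have h := eval_derivative_basis_node (Finset.range (n + 1)) (fun j : ℕ => c - a + j)
    (i := i) (a := a) (by simpa using by omega) (by simpa using by omega) hia
    (by simpa only [ne_eq, add_right_inj, Nat.cast_inj] using hia)
  simp only [sub_add_cancel, add_sub_add_left_eq_sub] at h
  have hc : ∀ j : ℕ, c - (c - a + j) = (a : ℝ) - j := fun j => by ring
  simp only [hc] at h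
  rw [h, prod_erase_range_sub n a ha, prod_erase_range_sub n i hi, Nat.cast_choose ℝ hi,
    Nat.cast_choose ℝ ha]
  have e1 : ((-1 : ℝ)) ^ (n - a) = (-1) ^ n * (-1) ^ a := by
    rw [← pow_add, show n + a = (n - a) + 2 * a by omega, pow_add, pow_mul]
    simp
  have e2 : ((-1 : ℝ)) ^ (n - i) = (-1) ^ n * (-1) ^ i := by
    rw [← pow_add, show n + i = (n - i) + 2 * i by omega, pow_add, pow_mul]
    simp
  have e3 : ((-1 : ℝ) ^ i) ^ 2 = 1 := by rw [← pow_mul, mul_comm, pow_mul]; simp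
  have e4 : ((-1 : ℝ) ^ n) ≠ 0 := by simp
  have e5 : ((-1 : ℝ) ^ i) ≠ 0 := by simp
  have f := fun k : ℕ => (Nat.cast_ne_zero (R := ℝ)).2 (Nat.factorial_ne_zero k)
  have f1 := f n
  have f2 := f i
  have f3 := f a
  have f4 := f (n - i)
  have f5 := f (n - a)
  rw [e1, e2, pow_succ, pow_add]
  field_simp
  linear_combination ((i : ℝ) - a) * -e3

/-! ### Reconstruction from averages of polynomials -/

/-- The averages of `Q'` over the cells `[k - 1/2, k + 1/2]`. -/
noncomputable def polyAvg (Q : ℝ[X]) (k : ℤ) : ℝ := Q.eval ((k : ℝ) + 1 / 2) - Q.eval ((k : ℝ) - 1 / 2)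

lemma primitiveValue_polyAvg (r s : ℕ) (Q : ℝ[X]) (i : ℕ) :
    primitiveValue r s (polyAvg Q) i
      = Q.eval ((s : ℝ) - r + 1 / 2 + i) - Q.eval ((s : ℝ) - r + 1 / 2) := by
  unfold primitiveValue polyAvg
  have := Finset.sum_range_sub (fun k : ℕ => Q.eval ((s : ℝ) - r + 1 / 2 + k)) i
  simp only [Nat.cast_zero, add_zero] at this
  rw [← this]
  refine Finset.sum_congr rfl fun k _ => ?_
  congr 2 <;> push_cast <;> ring

lemma injOn_nodes (c : ℝ) (S : Set ℕ) : Set.InjOn (fun i : ℕ => c + (i : ℝ)) S := by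
  intro i _ j _ h
  simpa using h

/-- The discrete primitive is `Q` at the interfaces up to an additive constant, which the derivative
of the interpolant does not see. -/
lemma reconPoly_polyAvg (r s : ℕ) (Q : ℝ[X]) :
    reconPoly r s (polyAvg Q) = derivative (Lagrange.interpolate (Finset.range (r + 1))
      (fun i : ℕ => (s : ℝ) - r + 1 / 2 + i) (fun i => Q.eval ((s : ℝ) - r + 1 / 2 + i))) := by
  unfold reconPoly
  have : primitiveValue r s (polyAvg Q) = (fun i : ℕ => Q.eval ((s : ℝ) - r + 1 / 2 + i))
      - (Q.eval ((s : ℝ) - r + 1 / 2)) • (1 : ℕ → ℝ) := by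
    funext i
    simp [primitiveValue_polyAvg]
  rw [this, map_sub, map_smul, Lagrange.interpolate_one (injOn_nodes _ _) (by simp)]
  simp

lemma reconPoly_polyAvg_of_natDegree_le (r s : ℕ) (Q : ℝ[X]) (hQ : Q.natDegree ≤ r) :
    reconPoly r s (polyAvg Q) = derivative Q := by
  rw [reconPoly_polyAvg, ← Lagrange.eq_interpolate (injOn_nodes _ _)]
  rw [Finset.card_range]
  exact (degree_le_of_natDegree_le hQ).trans_lt (by exact_mod_cast Nat.lt_succ_self r)

lemma primitiveValue_add (r s : ℕ) (v w : ℤ → ℝ) :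
    primitiveValue r s (v + w) = primitiveValue r s v + primitiveValue r s w := by
  funext i
  simp [primitiveValue, Finset.sum_add_distrib]

lemma primitiveValue_smul (r s : ℕ) (c : ℝ) (v : ℤ → ℝ) :
    primitiveValue r s (c • v) = c • primitiveValue r s v := by
  funext i
  simp [primitiveValue, Finset.mul_sum]

lemma reconPoly_add (r s : ℕ) (v w : ℤ → ℝ) :
    reconPoly r s (v + w) = reconPoly r s v + reconPoly r s w := by
  rw [reconPoly, primitiveValue_add, map_add, derivative_add]
  rfl

lemma reconPoly_smul (r s : ℕ) (c : ℝ) (v : ℤ → ℝ) :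
    reconPoly r s (c • v) = c • reconPoly r s v := by
  simp [reconPoly, primitiveValue_smul]

lemma subRecon_add (r s : ℕ) (v w : ℤ → ℝ) :
    subRecon r s (v + w) = subRecon r s v + subRecon r s w := by
  simp [subRecon, reconPoly_add]

lemma subRecon_smul (r s : ℕ) (c : ℝ) (v : ℤ → ℝ) :
    subRecon r s (c • v) = c * subRecon r s v := by
  simp [subRecon, reconPoly_smul]

lemma polyAvg_add (P Q : ℝ[X]) : polyAvg (P + Q) = polyAvg P + polyAvg Q := by
  funext k
  simp [polyAvg]
  ring

lemma polyAvg_smul (c : ℝ) (P : ℝ[X]) : polyAvg (c • P) = c • polyAvg P := by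
  funext k
  simp [polyAvg]
  ring

/-! ### The linear scheme -/

/-- Weighted difference formula for the derivative at `c` of an interpolant with node `c`. -/
lemma eval_derivative_interpolate_range (c : ℝ) (n a : ℕ) (ha : a ≤ n) (y : ℕ → ℝ) :
    (derivative (Lagrange.interpolate (Finset.range (n + 1)) (fun j : ℕ => c - a + j) y)).eval c
      = ∑ i ∈ Finset.range (n + 1),
          (-1) ^ (a + i + 1) * n.choose i / n.choose a / ((i : ℝ) - a) * (y i - y a) := by
  -- Subtracting the constant `y a` annihilates the coefficient of the basis polynomial at its own
  -- node, so its derivative there is never needed. The term `i = a` of the sum is zero, whatever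
  -- the value of the division by zero.
  have h1 : (derivative (Lagrange.interpolate (Finset.range (n + 1))
      (fun j : ℕ => c - a + j) y)).eval c
      = (derivative (Lagrange.interpolate (Finset.range (n + 1))
      (fun j : ℕ => c - a + j) (y - y a • (1 : ℕ → ℝ)))).eval c := by
    rw [map_sub, map_smul, Lagrange.interpolate_one (injOn_nodes _ _) (by simp)]
    simp
  rw [h1, Lagrange.interpolate_apply, derivative_sum, eval_finsetSum]
  refine Finset.sum_congr rfl fun i hi => ?_
  rw [derivative_C_mul, eval_C_mul]
  by_cases hia : i = a
  · subst hia
    simp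
  · rw [eval_derivative_basis_range c n a i ha (by simpa [Nat.lt_succ_iff] using hi) hia]
    simp
    ring

/-- The reconstruction with the optimal weights. -/
noncomputable def linRecon (r : ℕ) (v : ℤ → ℝ) : ℝ := ∑ s ∈ Finset.range r, optWeight r s * subRecon r s v

lemma linRecon_add (r : ℕ) (v w : ℤ → ℝ) : linRecon r (v + w) = linRecon r v + linRecon r w := by
  simp [linRecon, subRecon_add, mul_add, Finset.sum_add_distrib]

lemma linRecon_smul (r : ℕ) (c : ℝ) (v : ℤ → ℝ) : linRecon r (c • v) = c * linRecon r v := by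
  simp only [linRecon, subRecon_smul, Finset.mul_sum]
  exact Finset.sum_congr rfl fun s _ => by ring

/-- The difference formula of the substencil, with `n = r` and `a = r - s`, is re-indexed by `k = s
+ i` over the `2r` interfaces of the full stencil, so that different `s` can be added termwise. -/
lemma subRecon_polyAvg {r s : ℕ} (hs : s < r) (Q : ℝ[X]) :
    subRecon r s (polyAvg Q) = ∑ k ∈ Finset.range (2 * r),
      (-1) ^ (r + k + 1) * (if s ≤ k then (r.choose (k - s) : ℝ) else 0) / r.choose s
        / ((k : ℝ) - r) * (Q.eval (1 / 2 - (r : ℝ) + k) - Q.eval (1 / 2)) := by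
  have hc : ((r - s : ℕ) : ℝ) = r - s := Nat.cast_sub hs.le
  have hn : (fun i : ℕ => (s : ℝ) - r + 1 / 2 + i)
      = fun i : ℕ => 1 / 2 - ((r - s : ℕ) : ℝ) + i := by
    funext i
    rw [hc]
    ring
  rw [subRecon, reconPoly_polyAvg, hn, eval_derivative_interpolate_range _ _ _ (Nat.sub_le r s),
    show 2 * r = s + ((r + 1) + (r - 1 - s)) by omega,
    Finset.sum_range_add _ s (r + 1 + (r - 1 - s)),
    Finset.sum_range_add _ (r + 1) (r - 1 - s)]
  rw [Finset.sum_eq_zero (s := Finset.range s), zero_add,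
    Finset.sum_eq_zero (s := Finset.range (r - 1 - s)), add_zero]
  · refine Finset.sum_congr rfl fun i _ => ?_
    rw [if_pos (Nat.le_add_right s i), Nat.add_sub_cancel_left, Nat.choose_symm hs.le,
      show r + (s + i) + 1 = (r - s + i + 1) + 2 * s by omega, pow_add _ _ (2 * s), pow_mul]
    have e1 : (1 : ℝ) / 2 - r + ((s + i : ℕ) : ℝ) = s - r + 1 / 2 + i := by push_cast; ring
    have e2 : ((s + i : ℕ) : ℝ) - r = i - (r - s) := by push_cast; ring
    have e3 : (s : ℝ) - r + 1 / 2 + ((r : ℝ) - s) = 1 / 2 := by ring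
    rw [e1, e2, hc, e3]
    simp
  · intro i _
    rw [if_pos (by omega), Nat.choose_eq_zero_of_lt (by omega)]
    simp
  · intro i hi
    rw [if_neg (by simpa using hi)]
    simp

/-- The linear scheme is exact for polynomials of degree at most `2 r - 2`. -/
lemma linRecon_polyAvg {r : ℕ} (hr : 1 ≤ r) (Q : ℝ[X]) (hQ : Q.natDegree ≤ 2 * r - 1) :
    linRecon r (polyAvg Q) = (derivative Q).eval (1 / 2) := by
  have hdeg : Q.degree < ((Finset.range (2 * r - 1 + 1)).card : ℕ) := by
    rw [Finset.card_range]
    exact (degree_le_of_natDegree_le hQ).trans_lt (by exact_mod_cast Nat.lt_succ_self _)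
  have hsymm : ((2 * r - 1).choose (r - 1)) = (2 * r - 1).choose r :=
    Nat.choose_symm_of_eq_add (by omega)
  have hpos : 0 < (2 * r - 1).choose r := Nat.choose_pos (by omega)
  have hpos' : ((2 * r - 1).choose r : ℝ) ≠ 0 := by positivity
  rw [Lagrange.eq_interpolate (injOn_nodes (1 / 2 - (r : ℝ)) _) hdeg,
    eval_derivative_interpolate_range _ _ _ (by omega), ← Lagrange.eq_interpolate
      (injOn_nodes (1 / 2 - (r : ℝ)) _) hdeg, show 2 * r - 1 + 1 = 2 * r by omega]
  unfold linRecon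
  rw [Finset.sum_congr rfl fun s hs => by rw [subRecon_polyAvg (Finset.mem_range.1 hs)]]
  simp only [Finset.mul_sum]
  rw [Finset.sum_comm]
  refine Finset.sum_congr rfl fun k _ => ?_
  -- The factor `r.choose s` of the optimal weight cancels the denominator of the substencil
  -- formula. The remaining sum over `s` is Vandermonde's, and produces the coefficient of the full
  -- stencil (`n = 2r - 1`, `a = r`).
  rw [sub_add_cancel, ← sum_choose_mul_choose r k hr]
  push_cast
  rw [Finset.mul_sum, Finset.sum_div, Finset.sum_div, Finset.sum_mul]
  refine Finset.sum_congr rfl fun s hs => ?_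
  have h1 : ((r.choose s : ℕ) : ℝ) ≠ 0 := by
    exact_mod_cast (Nat.choose_pos (Finset.mem_range.1 hs).le).ne'
  unfold optWeight
  rw [hsymm]
  field_simp

/-! ### Positivity of the nonlinear weights -/

/-- The denominator is the convex combination `(1 - w) d² + w (1 - d)²`. -/
lemma mapM_denom_pos {d w : ℝ} (hd0 : 0 < d) (hd1 : d < 1) (hw0 : 0 ≤ w) (hw1 : w ≤ 1) :
    0 < d ^ 2 + (1 - 2 * d) * w := by
  nlinarith [mul_nonneg (sub_nonneg.2 hw1) (sq_nonneg d), mul_nonneg hw0 (sq_nonneg (1 - d)),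
    mul_pos hd0 hd0, mul_pos (sub_pos.2 hd1) (sub_pos.2 hd1)]

/-- The second factor of the numerator is `(w - d)² + d (1 - w)`, which could vanish only at `w = d
= 1`. -/
lemma mapM_pos {d w : ℝ} (hd0 : 0 < d) (hd1 : d < 1) (hw0 : 0 < w) (hw1 : w ≤ 1) :
    0 < mapM d w := by
  refine div_pos (mul_pos hw0 ?_) (mapM_denom_pos hd0 hd1 hw0.le hw1)
  nlinarith [sq_nonneg (w - 3 / 2 * d), mul_pos hd0 (sub_pos.2 hd1), sq_nonneg (w - d),
    mul_nonneg hd0.le (sub_nonneg.2 hw1)]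

lemma mapM_sub {d w : ℝ} (h : d ^ 2 + (1 - 2 * d) * w ≠ 0) :
    mapM d w - d = (w - d) ^ 3 / (d ^ 2 + (1 - 2 * d) * w) := by
  rw [mapM, div_sub' h]
  congr 1
  ring

lemma smoothness_nonneg (r s : ℕ) (v : ℤ → ℝ) : 0 ≤ smoothness r s v :=
  Finset.sum_nonneg fun _ _ => intervalIntegral.integral_nonneg (by norm_num)
    fun _ _ => sq_nonneg _

lemma normalize_pos {r : ℕ} {a : ℕ → ℝ} (ha : ∀ s < r, 0 < a s) {s : ℕ} (hs : s < r) :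
    0 < a s / ∑ l ∈ Finset.range r, a l ∧ a s / ∑ l ∈ Finset.range r, a l ≤ 1 := by
  have h1 : ∀ l ∈ Finset.range r, 0 < a l := fun l hl => ha l (Finset.mem_range.1 hl)
  have h2 : 0 < ∑ l ∈ Finset.range r, a l := Finset.sum_pos h1 ⟨s, Finset.mem_range.2 hs⟩
  exact ⟨div_pos (ha s hs) h2, (div_le_one h2).2
    (Finset.single_le_sum (fun l hl => (h1 l hl).le) (Finset.mem_range.2 hs))⟩

lemma weightM_mem {r : ℕ} (hr : 2 ≤ r) {ε : ℝ} (hε : 0 < ε) (v : ℤ → ℝ) (n : ℕ) :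
    ∀ s < r, 0 < weightM r ε v n s ∧ weightM r ε v n s ≤ 1 := by
  induction n with
  | zero =>
    intro s hs
    refine normalize_pos (fun l hl => ?_) hs
    have := smoothness_nonneg r l v
    exact div_pos (optWeight_pos hl) (by positivity)
  | succ n ih =>
    intro s hs
    exact normalize_pos (a := fun l => mapM (optWeight r l) (weightM r ε v n l))
      (fun l hl => mapM_pos (optWeight_pos hl) (optWeight_lt_one hr hl) (ih l hl).1 (ih l hl).2) hs

lemma sum_weightM {r : ℕ} (hr : 2 ≤ r) {ε : ℝ} (hε : 0 < ε) (v : ℤ → ℝ) (n : ℕ) :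
    ∑ s ∈ Finset.range r, weightM r ε v n s = 1 := by
  have hne : (Finset.range r).Nonempty := ⟨0, Finset.mem_range.2 (by omega)⟩
  cases n with
  | zero =>
    simp only [weightM, weightJS]
    rw [← Finset.sum_div, div_self]
    refine (Finset.sum_pos (fun l hl => ?_) hne).ne'
    have := smoothness_nonneg r l v
    exact div_pos (optWeight_pos (Finset.mem_range.1 hl)) (by positivity)
  | succ n =>
    simp only [weightM, mapStep]
    rw [← Finset.sum_div, div_self]
    refine (Finset.sum_pos (fun l hl => ?_) hne).ne'
    have hl' := Finset.mem_range.1 hl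
    have := weightM_mem hr hε v n l hl'
    exact mapM_pos (optWeight_pos hl') (optWeight_lt_one hr hl') this.1 this.2

/-! ### Asymptotics of the nonlinear weights -/

section Weights

variable {α : Type*} {l : Filter α} {g : α → ℝ}

/-- With `S` the sum of the `a_k`, the difference equals `((a_s - d_s) - d_s (S - 1)) / S`, and `S →
1` because the `d_k` sum to 1. -/
lemma isBigO_normalize_sub {r : ℕ} {d : ℕ → ℝ} {a : α → ℕ → ℝ}
    (hd : ∑ s ∈ Finset.range r, d s = 1) (hg : Tendsto g l (𝓝 0))
    (h : ∀ s < r, (fun p => a p s - d s) =O[l] g) {s : ℕ} (hs : s < r) :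
    (fun p => a p s / ∑ k ∈ Finset.range r, a p k - d s) =O[l] g := by
  have h1 : (fun p => ∑ k ∈ Finset.range r, a p k - 1) =O[l] g := by
    have : (fun p => ∑ k ∈ Finset.range r, (a p k - d k)) =O[l] g :=
      IsBigO.fun_sum fun k hk => h k (Finset.mem_range.1 hk)
    simpa [Finset.sum_sub_distrib, hd] using this
  have h2 : Tendsto (fun p => ∑ k ∈ Finset.range r, a p k) l (𝓝 1) :=
    tendsto_sub_nhds_zero_iff.1 (h1.trans_tendsto hg)
  have h3 : (fun p => (∑ k ∈ Finset.range r, a p k)⁻¹) =O[l] (fun _ => (1 : ℝ)) :=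
    (h2.inv₀ one_ne_zero).isBigO_one ℝ
  have h4 := ((h s hs).sub (h1.const_mul_left (d s))).mul h3
  refine (h4.congr' ?_ (by simp))
  filter_upwards [h2.eventually_ne one_ne_zero] with p hp
  field_simp
  ring

lemma isBigO_inv_sq_sub_one {η : α → ℝ} (hg : Tendsto g l (𝓝 0)) (h : η =O[l] g) :
    (fun p => 1 / (1 + η p) ^ 2 - 1) =O[l] g := by
  have h1 : Tendsto η l (𝓝 0) := h.trans_tendsto hg
  have h2 : Tendsto (fun p => 1 + η p) l (𝓝 1) := by simpa using h1.const_add 1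
  have h3 : Tendsto (fun p => -(2 + η p) / (1 + η p) ^ 2) l (𝓝 (-(2 + 0) / 1 ^ 2)) :=
    (h1.const_add 2).neg.div (h2.pow 2) (by norm_num)
  refine (h.mul (h3.isBigO_one ℝ)).congr' ?_ (by simp)
  filter_upwards [h2.eventually_ne one_ne_zero] with p hp
  field_simp
  ring

/-- Multiplying every `α_s` by the common factor `(ε + B)²` does not change the normalized weights
and turns `α_s` into `d_s / (1 + η_s)²`. Since `ε > 0`, `|η_s|` is at most the relative deviation of
`β_s` from `B`, uniformly in `ε`. -/
lemma isBigO_weightJS_sub {r : ℕ} (hr : 1 ≤ r) {ε B : α → ℝ} {v : α → ℤ → ℝ}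
    (hε : ∀ᶠ p in l, 0 < ε p) (hB : ∀ᶠ p in l, 0 < B p) (hg : Tendsto g l (𝓝 0))
    (h : ∀ s < r, (fun p => (smoothness r s (v p) - B p) / B p) =O[l] g) {s : ℕ} (hs : s < r) :
    (fun p => weightJS r (ε p) (v p) s - optWeight r s) =O[l] g := by
  set η : α → ℕ → ℝ := fun p k => (smoothness r k (v p) - B p) / (ε p + B p) with hη
  have h1 : ∀ k < r, (fun p => η p k) =O[l] g := by
    intro k hk
    refine IsBigO.trans (IsBigO.of_bound 1 ?_) (h k hk)
    filter_upwards [hε, hB] with p h1 h2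
    rw [one_mul, hη, norm_div, norm_div]
    refine div_le_div_of_nonneg_left (norm_nonneg _) (norm_pos_iff.2 h2.ne') ?_
    rw [Real.norm_eq_abs, Real.norm_eq_abs, abs_of_pos h2, abs_of_pos (by positivity)]
    linarith
  have h2 := isBigO_normalize_sub (a := fun p k => optWeight r k / (1 + η p k) ^ 2)
    (sum_optWeight hr) hg (fun k hk => ?_) hs
  · refine h2.congr' ?_ EventuallyEq.rfl
    filter_upwards [hε, hB] with p h1 h2
    have h3 : 0 < ε p + B p := by positivity
    have h4 : ∀ k, optWeight r k / (1 + η p k) ^ 2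
        = (ε p + B p) ^ 2 * alphaJS r (ε p) (v p) k := by
      intro k
      have : 1 + η p k = (ε p + smoothness r k (v p)) / (ε p + B p) := by
        rw [hη]
        field_simp
        ring
      have h5 : 0 < ε p + smoothness r k (v p) := by
        have := smoothness_nonneg r k (v p)
        positivity
      rw [this, alphaJS]
      field_simp
    simp only [h4]
    rw [← Finset.mul_sum, mul_div_mul_left _ _ (by positivity), weightJS]
  · refine ((isBigO_inv_sq_sub_one hg (h1 k hk)).const_mul_left (optWeight r k)).congr_left ?_
    intro p
    ring

lemma isBigO_weightM_sub {r : ℕ} (hr : 2 ≤ r) {ε : α → ℝ} {v : α → ℤ → ℝ}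
    (hg : Tendsto g l (𝓝 0))
    (h : ∀ s < r, (fun p => weightJS r (ε p) (v p) s - optWeight r s) =O[l] g) (n : ℕ) :
    ∀ s < r, (fun p => weightM r (ε p) (v p) n s - optWeight r s) =O[l]
      fun p => g p ^ 3 ^ n := by
  induction n with
  | zero => simpa [weightM] using h
  | succ n ih =>
    intro s hs
    refine isBigO_normalize_sub
      (a := fun p k => mapM (optWeight r k) (weightM r (ε p) (v p) n k))
      (sum_optWeight (by omega)) ?_ (fun k hk => ?_) hs
    · simpa using hg.pow (3 ^ (n + 1))
    · have hk0 := optWeight_pos hk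
      have hk1 := optWeight_lt_one hr hk
      set d := optWeight r k
      have hg' : Tendsto (fun p => g p ^ 3 ^ n) l (𝓝 0) := by simpa using hg.pow (3 ^ n)
      have h1 : Tendsto (fun p => weightM r (ε p) (v p) n k) l (𝓝 d) :=
        tendsto_sub_nhds_zero_iff.1 ((ih k hk).trans_tendsto hg')
      have hD : d ^ 2 + (1 - 2 * d) * d ≠ 0 :=
        (mapM_denom_pos hk0 hk1 hk0.le hk1.le).ne'
      have h2 : Tendsto (fun p => d ^ 2 + (1 - 2 * d) * weightM r (ε p) (v p) n k) l
          (𝓝 (d ^ 2 + (1 - 2 * d) * d)) := (h1.const_mul _).const_add _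
      refine (((ih k hk).pow 3).mul ((h2.inv₀ hD).isBigO_one ℝ)).congr' ?_ ?_
      · filter_upwards [h2.eventually_ne hD] with p hp
        rw [mapM_sub hp, div_eq_mul_inv]
      · refine Eventually.of_forall fun p => ?_
        simp only [mul_one]
        rw [← pow_mul, pow_succ]

end Weights

/-! ### The filter of fine meshes -/

/-- Triples `(h, ε, x)` of a mesh width `h → 0+`, a regularization parameter `ε > 0` and a cell
centre `x` within `K h` of `xc`. -/
def meshFilter (xc K : ℝ) : Filter (ℝ × ℝ × ℝ) :=
  comap Prod.fst (𝓝[>] 0) ⊓ 𝓟 {p | 0 < p.2.1 ∧ |p.2.2 - xc| ≤ K * p.1}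

lemma eventually_meshFilter {xc K : ℝ} {P : ℝ × ℝ × ℝ → Prop} :
    (∀ᶠ p in meshFilter xc K, P p) ↔ ∃ h₀ > 0, ∀ h, 0 < h → h < h₀ → ∀ ε, 0 < ε →
      ∀ x, |x - xc| ≤ K * h → P (h, ε, x) := by
  rw [meshFilter, eventually_inf_principal, eventually_comap,
    (nhdsGT_basis (0 : ℝ)).eventually_iff]
  constructor
  · rintro ⟨h₀, h0, H⟩
    exact ⟨h₀, h0, fun h h1 h2 ε hε x hx => H ⟨h1, h2⟩ (h, ε, x) rfl ⟨hε, hx⟩⟩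
  · rintro ⟨h₀, h0, H⟩
    refine ⟨h₀, h0, ?_⟩
    rintro _ ⟨h1, h2⟩ ⟨h, ε, x⟩ rfl ⟨hε, hx⟩
    exact H h h1 h2 ε hε x hx

lemma eventually_mesh_basic (xc K : ℝ) {h₁ : ℝ} (h1 : 0 < h₁) :
    ∀ᶠ p in meshFilter xc K, 0 < p.1 ∧ p.1 < h₁ ∧ 0 < p.2.1 ∧ |p.2.2 - xc| ≤ K * p.1 :=
  eventually_meshFilter.2 ⟨h₁, h1, fun _ a b _ c _ d => ⟨a, b, c, d⟩⟩

lemma bound_of_isBigO_mesh {xc K : ℝ} {F g : ℝ × ℝ × ℝ → ℝ} (h : F =O[meshFilter xc K] g) :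
    ∃ C > 0, ∃ h₀ > 0, ∀ h, 0 < h → h < h₀ → ∀ ε, 0 < ε →
      ∀ x, |x - xc| ≤ K * h → |F (h, ε, x)| ≤ C * |g (h, ε, x)| := by
  obtain ⟨C, hC, H⟩ := h.exists_pos
  exact ⟨C, hC, eventually_meshFilter.1 H.bound⟩

lemma tendsto_mesh_width (xc K : ℝ) :
    Tendsto (fun p : ℝ × ℝ × ℝ => p.1) (meshFilter xc K) (𝓝 0) := by
  refine Tendsto.mono_left ?_ inf_le_left
  exact tendsto_comap.mono_right nhdsWithin_le_nhds

lemma isBigO_mesh_pow (xc K : ℝ) {m n : ℕ} (h : m ≤ n) :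
    (fun p : ℝ × ℝ × ℝ => p.1 ^ n) =O[meshFilter xc K] fun p => p.1 ^ m := by
  refine IsBigO.of_bound 1 ?_
  filter_upwards [eventually_mesh_basic xc K one_pos] with p ⟨h0, h1, _⟩
  rw [one_mul, norm_pow, norm_pow, Real.norm_eq_abs, abs_of_pos h0]
  exact pow_le_pow_of_le_one h0.le h1.le h

lemma isBigO_mesh_shift (xc K c : ℝ) :
    (fun p : ℝ × ℝ × ℝ => p.2.2 + c * p.1 - xc) =O[meshFilter xc K] fun p => p.1 := by
  refine IsBigO.of_bound (K + |c|) ?_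
  filter_upwards [eventually_mesh_basic xc K one_pos] with p ⟨h0, _, _, hx⟩
  rw [Real.norm_eq_abs, Real.norm_eq_abs, abs_of_pos h0, add_sub_right_comm, add_mul]
  refine (abs_add_le _ _).trans (add_le_add hx ?_)
  rw [abs_mul, abs_of_pos h0]

lemma tendsto_mesh_shift (xc K c : ℝ) :
    Tendsto (fun p : ℝ × ℝ × ℝ => p.2.2 + c * p.1) (meshFilter xc K) (𝓝 xc) :=
  tendsto_sub_nhds_zero_iff.1 ((isBigO_mesh_shift xc K c).trans_tendsto (tendsto_mesh_width xc K))

/-! ### Taylor polynomials -/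

/-- The Taylor polynomial of degree `N` of `u` at `xc`, in the variable `x - xc`. -/
noncomputable def taylorPoly (u : ℝ → ℝ) (xc : ℝ) (N : ℕ) : ℝ[X] :=
  ∑ k ∈ Finset.range (N + 1), C (iteratedDeriv k u xc / k.factorial) * X ^ k

/-- A primitive of the Taylor polynomial. -/
noncomputable def taylorPrim (u : ℝ → ℝ) (xc : ℝ) (N : ℕ) : ℝ[X] :=
  ∑ k ∈ Finset.range (N + 1), C (iteratedDeriv k u xc / (k + 1).factorial) * X ^ (k + 1)

lemma derivative_taylorPrim (u : ℝ → ℝ) (xc : ℝ) (N : ℕ) :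
    derivative (taylorPrim u xc N) = taylorPoly u xc N := by
  rw [taylorPrim, derivative_sum, taylorPoly]
  refine Finset.sum_congr rfl fun k _ => ?_
  rw [derivative_C_mul_X_pow, Nat.add_sub_cancel, Nat.factorial_succ]
  congr 2
  push_cast
  field_simp

lemma natDegree_taylorPrim_le (u : ℝ → ℝ) (xc : ℝ) (N : ℕ) :
    (taylorPrim u xc N).natDegree ≤ N + 1 := by
  refine natDegree_sum_le_of_forall_le _ _ fun k hk => ?_
  exact (natDegree_C_mul_X_pow_le _ _).trans (Finset.mem_range.1 hk)

lemma coeff_taylorPoly (u : ℝ → ℝ) (xc : ℝ) {N k : ℕ} (hk : k ≤ N) :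
    (taylorPoly u xc N).coeff k = iteratedDeriv k u xc / k.factorial := by
  rw [taylorPoly, finsetSum_coeff, Finset.sum_eq_single_of_mem k (by simpa using by omega)]
  · simp
  · intro j _ hj
    simp [hj.symm]

lemma isBigO_sub_taylorPoly {u : ℝ → ℝ} {xc : ℝ} (hu : ContDiffAt ℝ ∞ u xc) (N : ℕ) :
    (fun x => u x - (taylorPoly u xc N).eval (x - xc)) =O[𝓝 xc] fun x => (x - xc) ^ (N + 1) := by
  obtain ⟨U, hU, hcd⟩ := (hu.of_le (m := (N + 1 : ℕ)) (by exact_mod_cast le_top)).contDiffOn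
    (m := (N + 1 : ℕ)) le_rfl (by simp)
  obtain ⟨δ, hδ, hball⟩ := Metric.mem_nhds_iff.1 hU
  have hxc : xc ∈ Metric.ball xc δ := Metric.mem_ball_self hδ
  -- The expansion is taken one order too far; its last term is then moved into the `O` remainder.
  have hO := taylor_isLittleO (n := N + 1) (convex_ball xc δ) hxc (hcd.mono hball)
  rw [Metric.isOpen_ball.nhdsWithin_eq hxc] at hO
  have h1 : ∀ x, taylorWithinEval u (N + 1) (Metric.ball xc δ) xc x
      = (taylorPoly u xc (N + 1)).eval (x - xc) := by
    intro x
    rw [taylor_within_apply, taylorPoly, eval_finsetSum]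
    refine Finset.sum_congr rfl fun k _ => ?_
    rw [iteratedDerivWithin_of_isOpen Metric.isOpen_ball hxc]
    simp only [eval_mul, eval_C, eval_pow, eval_X, smul_eq_mul]
    ring
  have h2 : (fun x => (iteratedDeriv (N + 1) u xc / (N + 1).factorial) * (x - xc) ^ (N + 1))
      =O[𝓝 xc] fun x => (x - xc) ^ (N + 1) := (isBigO_refl _ _).const_mul_left _
  refine (hO.isBigO.add h2).congr_left fun x => ?_
  rw [h1, taylorPoly, Finset.sum_range_succ, ← taylorPoly]
  simp only [eval_add, eval_mul, eval_C, eval_pow, eval_X]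
  ring

/-! ### Mesh averages and Taylor polynomials -/

/-- The polynomial `y ↦ G (h y + t) / h`. -/
noncomputable def meshPoly (G : ℝ[X]) (h t : ℝ) : ℝ[X] :=
  C (1 / h) * G.comp (C h * X + C t)

lemma eval_meshPoly (G : ℝ[X]) (h t y : ℝ) :
    (meshPoly G h t).eval y = 1 / h * G.eval (h * y + t) := by
  simp [meshPoly]

lemma natDegree_meshPoly_le (G : ℝ[X]) (h t : ℝ) : (meshPoly G h t).natDegree ≤ G.natDegree := by
  refine (natDegree_C_mul_le _ _).trans (natDegree_comp_le.trans ?_)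
  simpa using Nat.mul_le_mul_left G.natDegree (natDegree_linear_le (a := h) (b := t))

lemma iterate_derivative_comp_linear (P : ℝ[X]) (h t : ℝ) (l : ℕ) :
    derivative^[l] (P.comp (C h * X + C t))
      = C (h ^ l) * (derivative^[l] P).comp (C h * X + C t) := by
  induction l with
  | zero => simp
  | succ l ih =>
    rw [Function.iterate_succ_apply', ih, derivative_C_mul, derivative_comp,
      Function.iterate_succ_apply']
    simp only [derivative_add, derivative_C_mul, derivative_X, derivative_C, mul_one, add_zero]
    rw [pow_succ, C_mul]
    ring

lemma derivative_meshPoly (G : ℝ[X]) {h : ℝ} (hh : h ≠ 0) (t : ℝ) :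
    derivative (meshPoly G h t) = (derivative G).comp (C h * X + C t) := by
  have h1 := iterate_derivative_comp_linear G h t 1
  simp only [Function.iterate_one, pow_one] at h1
  rw [meshPoly, derivative_C_mul, h1, ← mul_assoc, ← C_mul, one_div_mul_cancel hh, C_1, one_mul]

lemma polyAvg_meshPoly (G : ℝ[X]) {h : ℝ} (x xc : ℝ) (k : ℤ) :
    polyAvg (meshPoly G h (x - xc)) k = 1 / h * ∫ ξ in (x + k * h - h / 2)..(x + k * h + h / 2),
      (derivative G).eval (ξ - xc) := by
  have h1 : ∫ ξ in (x + k * h - h / 2)..(x + k * h + h / 2), (derivative G).eval (ξ - xc)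
      = G.eval (x + k * h + h / 2 - xc) - G.eval (x + k * h - h / 2 - xc) := by
    refine intervalIntegral.integral_eq_sub_of_hasDerivAt (f := fun ξ => G.eval (ξ - xc))
      (fun ξ _ => ?_) ?_
    · simpa using (G.hasDerivAt (ξ - xc)).comp_sub_const ξ xc
    · apply Continuous.intervalIntegrable
      fun_prop
  rw [h1, polyAvg, eval_meshPoly, eval_meshPoly, ← mul_sub,
    show h * ((k : ℝ) + 1 / 2) + (x - xc) = x + k * h + h / 2 - xc by ring,
    show h * ((k : ℝ) - 1 / 2) + (x - xc) = x + k * h - h / 2 - xc by ring]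

lemma isBigO_cellAverage_sub {u : ℝ → ℝ} {xc : ℝ} (hu : ContDiffAt ℝ ∞ u xc) (K : ℝ) (N : ℕ)
    (k : ℤ) :
    (fun p : ℝ × ℝ × ℝ => cellAverage u p.1 (p.2.2 + k * p.1)
        - polyAvg (meshPoly (taylorPrim u xc N) p.1 (p.2.2 - xc)) k)
      =O[meshFilter xc K] fun p => p.1 ^ (N + 1) := by
  obtain ⟨C, hC, hb⟩ := (isBigO_sub_taylorPoly hu N).exists_pos
  have hcont : ∀ᶠ x in 𝓝 xc, ContinuousAt u x := by
    have := (hu.of_le (m := 1) (by exact_mod_cast le_top)).eventually (by simp)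
    exact this.mono fun x hx => hx.continuousAt
  obtain ⟨δ, hδ, hball⟩ := Metric.eventually_nhds_iff.1 (hb.bound.and hcont)
  -- Every point of the `k`-th neighbouring cell is within `h/2 + |k| h + |K| h ≤ M h` of `xc`.
  set M : ℝ := |K| + |(k : ℝ)| + 1 with hM
  have hM0 : 0 < M := by positivity
  refine IsBigO.of_bound (C * M ^ (N + 1)) ?_
  filter_upwards [eventually_mesh_basic xc K (div_pos hδ hM0)] with ⟨h, ε, x⟩ ⟨h0, h1, _, hx⟩
  simp only at h0 h1 hx ⊢
  have hab : x + k * h - h / 2 ≤ x + k * h + h / 2 := by linarith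
  have hdist : ∀ ξ ∈ Set.Icc (x + k * h - h / 2) (x + k * h + h / 2), |ξ - xc| ≤ M * h := by
    intro ξ hξ
    have e1 : |ξ - (x + k * h)| ≤ h / 2 := abs_le.2 ⟨by linarith [hξ.1], by linarith [hξ.2]⟩
    have e2 : |(k : ℝ) * h| = |(k : ℝ)| * h := by rw [abs_mul, abs_of_pos h0]
    have e3 : K * h ≤ |K| * h := by gcongr; exact le_abs_self K
    calc |ξ - xc| = |(ξ - (x + k * h)) + (k * h + (x - xc))| := by ring_nf
      _ ≤ |ξ - (x + k * h)| + (|(k : ℝ) * h| + |x - xc|) :=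
        (abs_add_le _ _).trans (add_le_add le_rfl (abs_add_le _ _))
      _ ≤ h / 2 + (|(k : ℝ)| * h + |K| * h) := by rw [e2]; gcongr; exact hx.trans e3
      _ ≤ M * h := by rw [hM]; linarith
  have hMh : M * h < δ := by rwa [lt_div_iff₀ hM0, mul_comm] at h1
  have hpt : ∀ ξ ∈ Set.Icc (x + k * h - h / 2) (x + k * h + h / 2),
      ‖u ξ - (taylorPoly u xc N).eval (ξ - xc)‖ ≤ C * ‖(ξ - xc) ^ (N + 1)‖ ∧ ContinuousAt u ξ :=
    fun ξ hξ => hball (by rw [Real.dist_eq]; exact (hdist ξ hξ).trans_lt hMh)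
  have hi1 : IntervalIntegrable u MeasureTheory.volume
      (x + k * h - h / 2) (x + k * h + h / 2) := by
    apply ContinuousOn.intervalIntegrable
    rw [Set.uIcc_of_le hab]
    exact fun ξ hξ => (hpt ξ hξ).2.continuousWithinAt
  have hi2 : IntervalIntegrable (fun ξ => (taylorPoly u xc N).eval (ξ - xc)) MeasureTheory.volume
      (x + k * h - h / 2) (x + k * h + h / 2) := by
    apply Continuous.intervalIntegrable
    fun_prop
  rw [cellAverage, polyAvg_meshPoly, derivative_taylorPrim, ← mul_sub,
    ← intervalIntegral.integral_sub hi1 hi2, norm_mul, norm_pow]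
  have hint := intervalIntegral.norm_integral_le_of_norm_le_const
    (f := fun ξ => u ξ - (taylorPoly u xc N).eval (ξ - xc))
    (a := x + k * h - h / 2) (b := x + k * h + h / 2) (C := C * (M * h) ^ (N + 1)) (by
      intro ξ hξ
      rw [Set.uIoc_of_le hab] at hξ
      have hξ' := Set.Ioc_subset_Icc_self hξ
      refine (hpt ξ hξ').1.trans ?_
      rw [norm_pow, Real.norm_eq_abs]
      gcongr
      exact hdist ξ hξ')
  rw [show x + k * h + h / 2 - (x + k * h - h / 2) = h by ring, abs_of_pos h0] at hint
  calc ‖1 / h‖ * _ ≤ ‖1 / h‖ * (C * (M * h) ^ (N + 1) * h) := by gcongr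
    _ = C * M ^ (N + 1) * ‖h‖ ^ (N + 1) := by
      rw [Real.norm_eq_abs, Real.norm_eq_abs, abs_of_pos h0, abs_of_pos (by positivity), mul_pow]
      field_simp

lemma isBigO_interface_sub {u : ℝ → ℝ} {xc : ℝ} (hu : ContDiffAt ℝ ∞ u xc) (K : ℝ) (N : ℕ) :
    (fun p : ℝ × ℝ × ℝ => u (p.2.2 + p.1 / 2)
        - (derivative (meshPoly (taylorPrim u xc N) p.1 (p.2.2 - xc))).eval (1 / 2))
      =O[meshFilter xc K] fun p => p.1 ^ (N + 1) := by
  have h1 := ((isBigO_sub_taylorPoly hu N).comp_tendsto (tendsto_mesh_shift xc K (1 / 2))).trans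
    ((isBigO_mesh_shift xc K (1 / 2)).pow (N + 1))
  refine h1.congr' ?_ EventuallyEq.rfl
  filter_upwards [eventually_mesh_basic xc K one_pos] with p hp
  rw [derivative_meshPoly _ hp.1.ne', derivative_taylorPrim, Function.comp_apply]
  simp only [eval_comp, eval_add, eval_mul, eval_C, eval_X]
  congr 2 <;> ring

/-! ### Stability of the reconstruction -/

lemma exists_bound_eval (P : ℝ[X]) (M : ℝ) : ∃ C, 0 < C ∧ ∀ y, |y| ≤ M → |P.eval y| ≤ C := by
  obtain ⟨C, hC⟩ := (isCompact_Icc (a := -M) (b := M)).exists_bound_of_continuousOn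
    (f := fun y => P.eval y) (by fun_prop)
  exact ⟨max C 1, by positivity, fun y hy => (hC y (abs_le.1 hy)).trans (le_max_left _ _)⟩

section Stability

variable {α : Type*} {l : Filter α} {g : α → ℝ}

/-- In the cell variable the basis polynomials do not depend on the mesh, so the reconstruction is a
fixed linear map of finitely many data. -/
lemma exists_isBigO_bound_reconPoly {w : α → ℤ → ℝ} (hw : ∀ k, (fun p => w p k) =O[l] g)
    (r s i : ℕ) : ∃ b : α → ℝ, b =O[l] g ∧ ∀ p y, |y| ≤ 1 / 2 →
      |(derivative^[i] (reconPoly r s (w p))).eval y| ≤ b p := by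
  choose M hM0 hM using fun j : ℕ => exists_bound_eval (derivative^[i] (derivative
    (Lagrange.basis (Finset.range (r + 1)) (fun i : ℕ => (s : ℝ) - r + 1 / 2 + i) j))) (1 / 2)
  refine ⟨fun p => ∑ j ∈ Finset.range (r + 1), |primitiveValue r s (w p) j| * M j, ?_, ?_⟩
  · refine IsBigO.fun_sum fun j _ => ?_
    have h1 : (fun p => primitiveValue r s (w p) j) =O[l] g := IsBigO.fun_sum fun k _ => hw _
    refine (h1.abs_left.const_mul_left (M j)).congr_left fun p => ?_
    ring
  · intro p y hy
    rw [reconPoly, Lagrange.interpolate_apply, derivative_sum, iterate_derivative_sum,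
      eval_finsetSum]
    refine (Finset.abs_sum_le_sum_abs _ _).trans (Finset.sum_le_sum fun j _ => ?_)
    rw [derivative_C_mul, iterate_derivative_C_mul, eval_C_mul, abs_mul]
    exact mul_le_mul_of_nonneg_left (hM j y hy) (abs_nonneg _)

lemma isBigO_subRecon {w : α → ℤ → ℝ} (hw : ∀ k, (fun p => w p k) =O[l] g) (r s : ℕ) :
    (fun p => subRecon r s (w p)) =O[l] g := by
  obtain ⟨b, hb, h⟩ := exists_isBigO_bound_reconPoly hw r s 0
  refine IsBigO.trans (IsBigO.of_bound 1 (Eventually.of_forall fun p => ?_)) hb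
  rw [one_mul]
  exact (h p (1 / 2) (by norm_num)).trans (le_abs_self _)

end Stability

lemma abs_integral_sq_add_sub_le (P W : ℝ[X]) {a b : ℝ}
    (hP : ∀ y, |y| ≤ 1 / 2 → |P.eval y| ≤ a) (hW : ∀ y, |y| ≤ 1 / 2 → |W.eval y| ≤ b) :
    |(∫ y in (-(1 / 2) : ℝ)..(1 / 2), ((P + W).eval y) ^ 2)
      - ∫ y in (-(1 / 2) : ℝ)..(1 / 2), (P.eval y) ^ 2| ≤ 2 * (a * b) + b * b := by
  rw [← intervalIntegral.integral_sub (Continuous.intervalIntegrable (by fun_prop) _ _)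
    (Continuous.intervalIntegrable (by fun_prop) _ _)]
  have := intervalIntegral.norm_integral_le_of_norm_le_const (a := (-(1 / 2) : ℝ)) (b := 1 / 2)
    (f := fun y => ((P + W).eval y) ^ 2 - (P.eval y) ^ 2) (C := 2 * (a * b) + b * b) (by
      intro y hy
      rw [Set.uIoc_of_le (by norm_num)] at hy
      have hy' : |y| ≤ 1 / 2 := abs_le.2 ⟨hy.1.le, hy.2⟩
      have h1 := hP y hy'
      have h2 := hW y hy'
      have ha := (abs_nonneg _).trans h1
      have hb := (abs_nonneg _).trans h2
      rw [eval_add, show (P.eval y + W.eval y) ^ 2 - (P.eval y) ^ 2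
        = 2 * (P.eval y * W.eval y) + W.eval y * W.eval y by ring, Real.norm_eq_abs]
      refine (abs_add_le _ _).trans ?_
      rw [abs_mul, abs_mul, abs_mul, abs_two]
      gcongr)
  norm_num at this ⊢
  exact this

/-! ### Smoothness indicators near a critical point -/

/-- The cell averages of `u` around the cell with centre `p.2.2`, on a mesh of width `p.1`. -/
noncomputable def meshData (u : ℝ → ℝ) (p : ℝ × ℝ × ℝ) (k : ℤ) : ℝ :=
  cellAverage u p.1 (p.2.2 + k * p.1)

/-- The polynomial in the cell variable whose derivative is the Taylor polynomial of `u`. -/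
noncomputable def meshTaylor (u : ℝ → ℝ) (xc : ℝ) (N : ℕ) (p : ℝ × ℝ × ℝ) : ℝ[X] :=
  meshPoly (taylorPrim u xc N) p.1 (p.2.2 - xc)

lemma natDegree_meshTaylor_le (u : ℝ → ℝ) (xc : ℝ) (N : ℕ) (p : ℝ × ℝ × ℝ) :
    (meshTaylor u xc N p).natDegree ≤ N + 1 :=
  (natDegree_meshPoly_le _ _ _).trans (natDegree_taylorPrim_le _ _ _)

lemma eval_iterate_derivative_meshTaylor (u : ℝ → ℝ) (xc : ℝ) (N : ℕ) {p : ℝ × ℝ × ℝ}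
    (hp : p.1 ≠ 0) (i : ℕ) (y : ℝ) :
    (derivative^[i] (derivative (meshTaylor u xc N p))).eval y
      = p.1 ^ i * (derivative^[i] (taylorPoly u xc N)).eval (p.1 * y + (p.2.2 - xc)) := by
  rw [meshTaylor, derivative_meshPoly _ hp, derivative_taylorPrim, iterate_derivative_comp_linear]
  simp

lemma exists_bound_eval_of_X_pow_dvd {P : ℝ[X]} {q : ℕ} (h : X ^ q ∣ P) :
    ∃ C, 0 < C ∧ ∀ t, |t| ≤ 1 → |P.eval t| ≤ C * |t| ^ q := by
  obtain ⟨S, rfl⟩ := h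
  obtain ⟨C, hC, hS⟩ := exists_bound_eval S 1
  refine ⟨C, hC, fun t ht => ?_⟩
  rw [eval_mul, eval_pow, eval_X, abs_mul, abs_pow, mul_comm]
  exact mul_le_mul_of_nonneg_right (hS t ht) (by positivity)

lemma abs_cell_variable_le {K h t y : ℝ} (h0 : 0 < h) (ht : |t| ≤ K * h) (hy : |y| ≤ 1 / 2) :
    |h * y + t| ≤ (|K| + 1) * h := by
  refine (abs_add_le _ _).trans ?_
  rw [abs_mul, abs_of_pos h0]
  nlinarith [le_abs_self K]

/-- Differentiating `i` times in `y` gives `h^i`, and for `i ≤ m` the vanishing derivatives of `u`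
leave a further factor `(x - xc)^(m+1-i)`. The case `i = 0` is excluded since `u(xc)` may be
nonzero. -/
lemma exists_bound_derivative_meshTaylor {u : ℝ → ℝ} {xc : ℝ} {m : ℕ}
    (hcp : IsCriticalPointOfOrder u xc m) {N : ℕ} (hN : m ≤ N) (K : ℝ) {i : ℕ} (hi : 1 ≤ i) :
    ∃ C, ∀ᶠ p in meshFilter xc K, ∀ y, |y| ≤ 1 / 2 →
      |(derivative^[i] (derivative (meshTaylor u xc N p))).eval y| ≤ C * p.1 ^ (m + 1) := by
  have hdvd : X ^ (m + 1 - i) ∣ derivative^[i] (taylorPoly u xc N) := by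
    rw [X_pow_dvd_iff]
    intro k hk
    rw [coeff_iterate_derivative, coeff_taylorPoly _ _ (by omega), hcp.1 _ (by omega) (by omega)]
    simp
  obtain ⟨C, hC, hb⟩ := exists_bound_eval_of_X_pow_dvd hdvd
  have hM : 0 < |K| + 1 := by positivity
  refine ⟨C * (|K| + 1) ^ (m + 1 - i), ?_⟩
  filter_upwards [eventually_mesh_basic xc K (div_pos one_pos hM),
    eventually_mesh_basic xc K one_pos] with p ⟨h0, h1, _, hx⟩ ⟨_, h1', _⟩ y hy
  have h2 := abs_cell_variable_le h0 hx hy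
  rw [lt_div_iff₀ hM, mul_comm] at h1
  rw [eval_iterate_derivative_meshTaylor _ _ _ h0.ne', abs_mul, abs_of_pos (pow_pos h0 i)]
  calc p.1 ^ i * |(derivative^[i] (taylorPoly u xc N)).eval (p.1 * y + (p.2.2 - xc))|
      ≤ p.1 ^ i * (C * ((|K| + 1) * p.1) ^ (m + 1 - i)) := by
        gcongr
        exact (hb _ (h2.trans h1.le)).trans (by gcongr)
    _ = C * (|K| + 1) ^ (m + 1 - i) * p.1 ^ (i + (m + 1 - i)) := by
        rw [mul_pow, pow_add]
        ring
    _ ≤ C * (|K| + 1) ^ (m + 1 - i) * p.1 ^ (m + 1) := by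
        gcongr ?_ * ?_
        -- For `i > m + 1` the truncated subtraction makes the exponent `i`, which is larger still.
        exact pow_le_pow_of_le_one h0.le h1'.le (by omega)

/-- The smoothness indicator of the Taylor polynomial. -/
noncomputable def taylorSmoothness (r : ℕ) (u : ℝ → ℝ) (xc : ℝ) (p : ℝ × ℝ × ℝ) : ℝ :=
  ∑ i ∈ Finset.Icc 1 (r - 1), ∫ y in (-(1 / 2) : ℝ)..(1 / 2),
    ((derivative^[i] (derivative (meshTaylor u xc (r - 1) p))).eval y) ^ 2

/-- The single summand of order `m + 1` suffices: that derivative of the Taylor polynomial is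
nonzero at `xc`, hence at least half its size there on the whole cell. `m + 1 ≤ r - 1` ensures that
this summand is present. -/
lemma exists_le_taylorSmoothness {u : ℝ → ℝ} {xc : ℝ} {r m : ℕ}
    (hcp : IsCriticalPointOfOrder u xc m) (hm : m + 1 ≤ r - 1) (K : ℝ) :
    ∃ c > 0, ∀ᶠ p in meshFilter xc K, c * p.1 ^ (2 * (m + 1)) ≤ taylorSmoothness r u xc p := by
  set T := derivative^[m + 1] (taylorPoly u xc (r - 1)) with hT
  have hT0 : T.eval 0 ≠ 0 := by
    rw [← coeff_zero_eq_eval_zero, hT, coeff_iterate_derivative, zero_add,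
      coeff_taylorPoly _ _ hm, Nat.descFactorial_self, nsmul_eq_mul]
    have := hcp.2
    positivity
  have hcont : Tendsto (fun t => |T.eval t|) (𝓝 0) (𝓝 |T.eval 0|) :=
    (T.continuous.tendsto 0).abs
  have hhalf : |T.eval 0| / 2 < |T.eval 0| := half_lt_self (abs_pos.2 hT0)
  obtain ⟨δ, hδ, hb⟩ := Metric.eventually_nhds_iff.1 (hcont.eventually (lt_mem_nhds hhalf))
  have hM : 0 < |K| + 1 := by positivity
  refine ⟨(|T.eval 0| / 2) ^ 2, by positivity, ?_⟩
  filter_upwards [eventually_mesh_basic xc K (div_pos hδ hM)] with p ⟨h0, h1, _, hx⟩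
  rw [lt_div_iff₀ hM, mul_comm] at h1
  have h2 : ∀ y ∈ Set.Icc (-(1 / 2) : ℝ) (1 / 2), (|T.eval 0| / 2) ^ 2 * p.1 ^ (2 * (m + 1))
      ≤ ((derivative^[m + 1] (derivative (meshTaylor u xc (r - 1) p))).eval y) ^ 2 := by
    intro y hy
    have h3 : |T.eval 0| / 2 < |T.eval (p.1 * y + (p.2.2 - xc))| := by
      apply hb
      rw [Real.dist_eq, sub_zero]
      exact (abs_cell_variable_le h0 hx (abs_le.2 hy)).trans_lt h1
    rw [eval_iterate_derivative_meshTaylor _ _ _ h0.ne', ← hT, mul_pow, ← sq_abs (T.eval _),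
      ← pow_mul, mul_comm (m + 1) 2, mul_comm]
    gcongr
  have h3 := intervalIntegral.integral_mono_on (a := -(1 / 2)) (b := 1 / 2)
    (μ := MeasureTheory.volume) (by norm_num)
    (Continuous.intervalIntegrable (by fun_prop) _ _)
    (Continuous.intervalIntegrable (by fun_prop) _ _) h2
  rw [intervalIntegral.integral_const] at h3
  norm_num at h3
  have h4 := Finset.single_le_sum (s := Finset.Icc 1 (r - 1)) (f := fun i =>
    ∫ y in (-(1 / 2) : ℝ)..(1 / 2),
      ((derivative^[i] (derivative (meshTaylor u xc (r - 1) p))).eval y) ^ 2)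
    (fun i _ => intervalIntegral.integral_nonneg (by norm_num) fun _ _ => sq_nonneg _)
    (Finset.mem_Icc.2 ⟨by omega, hm⟩)
  refine le_trans ?_ h4
  norm_num
  exact h3

lemma isBigO_meshData_sub {u : ℝ → ℝ} {xc : ℝ} (hu : ContDiffAt ℝ ∞ u xc) (K : ℝ) (N : ℕ)
    (k : ℤ) : (fun p => (meshData u p - polyAvg (meshTaylor u xc N p)) k)
      =O[meshFilter xc K] fun p => p.1 ^ (N + 1) :=
  isBigO_cellAverage_sub hu K N k

/-- Split `p_s` into the Taylor polynomial and a remainder `O(h^r)`. The cross term is `h^(m+1)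
h^r`; the squared remainder is no larger because `m + 1 ≤ r`. -/
lemma isBigO_smoothness_sub {u : ℝ → ℝ} {xc : ℝ} (hu : ContDiffAt ℝ ∞ u xc) {r m : ℕ}
    (hcp : IsCriticalPointOfOrder u xc m) (hm : m + 1 ≤ r - 1) (K : ℝ) (s : ℕ) :
    (fun p => smoothness r s (meshData u p) - taylorSmoothness r u xc p)
      =O[meshFilter xc K] fun p => p.1 ^ (m + 1 + r) := by
  simp only [smoothness, taylorSmoothness, ← Finset.sum_sub_distrib]
  refine IsBigO.fun_sum fun i hi => ?_
  obtain ⟨b, hbO, hb⟩ := exists_isBigO_bound_reconPoly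
    (isBigO_meshData_sub hu K (r - 1)) r s i
  rw [show r - 1 + 1 = r by omega] at hbO
  obtain ⟨C, hC⟩ := exists_bound_derivative_meshTaylor hcp (N := r - 1) (by omega) K
    (Finset.mem_Icc.1 hi).1
  have hO : (fun p => 2 * (C * p.1 ^ (m + 1) * b p) + b p * b p)
      =O[meshFilter xc K] fun p => p.1 ^ (m + 1 + r) := by
    have h1 : (fun p : ℝ × ℝ × ℝ => C * p.1 ^ (m + 1)) =O[meshFilter xc K]
        fun p => p.1 ^ (m + 1) := (isBigO_refl _ _).const_mul_left C
    have h2 := ((h1.mul hbO).const_mul_left 2).add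
      ((hbO.trans (isBigO_mesh_pow xc K (by omega : m + 1 ≤ r))).mul hbO)
    simpa only [← pow_add] using h2
  refine IsBigO.trans (IsBigO.of_bound 1 ?_) hO
  filter_upwards [hC] with p hp
  have hsplit : reconPoly r s (meshData u p) = derivative (meshTaylor u xc (r - 1) p)
      + reconPoly r s (meshData u p - polyAvg (meshTaylor u xc (r - 1) p)) := by
    rw [← reconPoly_polyAvg_of_natDegree_le r s _
      ((natDegree_meshTaylor_le u xc (r - 1) p).trans (by omega)), ← reconPoly_add,
      add_sub_cancel]
  rw [one_mul, hsplit, iterate_map_add]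
  exact (abs_integral_sq_add_sub_le _ _ hp (hb p)).trans (le_abs_self _)

/-- The weights of the mapped scheme near a critical point of order `m`. -/
lemma isBigO_weightM_meshData {u : ℝ → ℝ} {xc : ℝ} (hu : ContDiffAt ℝ ∞ u xc) {r m : ℕ}
    (hr : 2 ≤ r) (hcp : IsCriticalPointOfOrder u xc m) (hm : m ≤ r - 1) (K : ℝ) (n : ℕ)
    {s : ℕ} (hs : s < r) :
    (fun p => weightM r p.2.1 (meshData u p) n s - optWeight r s)
      =O[meshFilter xc K] fun p => p.1 ^ (3 ^ n * (r - 1 - m)) := by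
  have hε : ∀ᶠ p in meshFilter xc K, 0 < p.2.1 :=
    (eventually_mesh_basic xc K one_pos).mono fun p hp => hp.2.2.1
  -- For `m = r - 1` the smoothness indicators give no information, but the exponent is 0 and the
  -- weights lie in `(0, 1]`.
  rcases hm.eq_or_lt with rfl | hm
  · rw [Nat.sub_self, mul_zero]
    refine IsBigO.of_bound 1 ?_
    filter_upwards [hε] with p hp
    have h1 := weightM_mem hr hp (meshData u p) n s hs
    have h2 := optWeight_pos hs
    have h3 := optWeight_lt_one hr hs
    rw [pow_zero, norm_one, mul_one, Real.norm_eq_abs, abs_le]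
    constructor <;> linarith
  · obtain ⟨c, hc, hB⟩ := exists_le_taylorSmoothness hcp hm K
    have hh : ∀ᶠ p in meshFilter xc K, 0 < p.1 :=
      (eventually_mesh_basic xc K one_pos).mono fun p hp => hp.1
    have hg : Tendsto (fun p : ℝ × ℝ × ℝ => p.1 ^ (r - 1 - m)) (meshFilter xc K) (𝓝 0) := by
      simpa [show r - 1 - m ≠ 0 by omega] using (tendsto_mesh_width xc K).pow (r - 1 - m)
    have hinv : (fun p => (taylorSmoothness r u xc p)⁻¹) =O[meshFilter xc K]
        fun p => (p.1 ^ (2 * (m + 1)))⁻¹ := by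
      refine IsBigO.of_bound c⁻¹ ?_
      filter_upwards [hB, hh] with p h1 h2
      have h3 : 0 < c * p.1 ^ (2 * (m + 1)) := by positivity
      rw [Real.norm_eq_abs, Real.norm_eq_abs, abs_of_pos (inv_pos.2 (h3.trans_le h1)),
        abs_of_pos (by positivity), ← mul_inv]
      exact inv_anti₀ h3 h1
    have hJS := fun k (hk : k < r) => isBigO_weightJS_sub (l := meshFilter xc K)
      (g := fun p => p.1 ^ (r - 1 - m)) (ε := fun p => p.2.1) (B := taylorSmoothness r u xc)
      (v := meshData u) (by omega : 1 ≤ r) hε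
      (by filter_upwards [hB, hh] with p h1 h2 using lt_of_lt_of_le (by positivity) h1) hg
      (fun s _ => by
        refine ((isBigO_smoothness_sub hu hcp hm K s).mul hinv).congr' ?_ ?_
        · exact Eventually.of_forall fun p => (div_eq_mul_inv _ _).symm
        · filter_upwards [hh] with p hp
          rw [show m + 1 + r = (r - 1 - m) + 2 * (m + 1) by omega, pow_add,
            mul_inv_cancel_right₀ (by positivity)]) hk
    refine (isBigO_weightM_sub hr hg hJS n s hs).congr_right fun p => ?_
    rw [← pow_mul, mul_comm]

/-! ### Error of the linear scheme -/

/-- The top coefficient does not depend on the shift `t`; this is what makes the leading error the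
same at neighbouring interfaces. -/
lemma coeff_meshPoly {G : ℝ[X]} {M : ℕ} (hG : G.natDegree ≤ M) (h t : ℝ) :
    (meshPoly G h t).coeff M = 1 / h * (h ^ M * G.coeff M) := by
  have hM : ((M.descFactorial M : ℕ) : ℝ) ≠ 0 := by
    rw [Nat.descFactorial_self]
    positivity
  have h1 : derivative^[M] G = C ((M.descFactorial M : ℝ) * G.coeff M) := by
    rw [eq_C_of_natDegree_eq_zero (p := derivative^[M] G) (Nat.eq_zero_of_le_zero
      ((natDegree_iterate_derivative G M).trans (by omega))), coeff_iterate_derivative, zero_add,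
      nsmul_eq_mul]
  have h2 := congrArg (fun P => coeff P 0) (iterate_derivative_comp_linear G h t M)
  simp only [coeff_iterate_derivative, zero_add, nsmul_eq_mul, h1, C_comp, coeff_C_mul,
    coeff_C_zero] at h2
  rw [meshPoly, coeff_C_mul]
  congr 1
  apply mul_left_cancel₀ hM
  rw [h2]
  ring

lemma linRecon_polyAvg_sub {r : ℕ} (hr : 1 ≤ r) {Q : ℝ[X]} (hQ : Q.natDegree ≤ 2 * r) :
    linRecon r (polyAvg Q) - (derivative Q).eval (1 / 2) = Q.coeff (2 * r)
      * (linRecon r (polyAvg (X ^ (2 * r))) - (derivative (X ^ (2 * r) : ℝ[X])).eval (1 / 2)) := by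
  obtain ⟨R, hR, hdeg⟩ : ∃ R : ℝ[X], Q = R + Q.coeff (2 * r) • X ^ (2 * r)
      ∧ R.natDegree ≤ 2 * r - 1 := by
    refine ⟨Q - Q.coeff (2 * r) • X ^ (2 * r), by ring, ?_⟩
    rw [natDegree_le_iff_coeff_eq_zero]
    intro k hk
    rcases (by omega : k = 2 * r ∨ 2 * r < k) with rfl | h
    · simp
    · simp [coeff_X_pow, h.ne', coeff_eq_zero_of_natDegree_lt (hQ.trans_lt h)]
  generalize Q.coeff (2 * r) = c at hR
  subst hR
  rw [polyAvg_add, polyAvg_smul, linRecon_add, linRecon_smul, linRecon_polyAvg hr R hdeg,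
    derivative_add, derivative_smul, eval_add, eval_smul, smul_eq_mul]
  ring

/-- Exactness one degree lower leaves only the top coefficient of the Taylor primitive of degree at
most `2r`, scaled by `h^(2r-1)`. `A` is chosen before `K` so that the same constant serves for
shifted cells. -/
lemma exists_isBigO_linRecon_sub {u : ℝ → ℝ} {xc : ℝ} (hu : ContDiffAt ℝ ∞ u xc) {r : ℕ}
    (hr : 1 ≤ r) : ∃ A : ℝ, ∀ K : ℝ,
    (fun p => linRecon r (meshData u p) - u (p.2.2 + p.1 / 2) - A * p.1 ^ (2 * r - 1))
      =O[meshFilter xc K] fun p => p.1 ^ (2 * r) := by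
  refine ⟨(taylorPrim u xc (2 * r - 1)).coeff (2 * r) * (linRecon r (polyAvg (X ^ (2 * r)))
    - (derivative (X ^ (2 * r) : ℝ[X])).eval (1 / 2)), fun K => ?_⟩
  have h1 : (fun p => linRecon r (meshData u p - polyAvg (meshTaylor u xc (2 * r - 1) p)))
      =O[meshFilter xc K] fun p => p.1 ^ (2 * r - 1 + 1) :=
    IsBigO.fun_sum fun s _ =>
      (isBigO_subRecon (isBigO_meshData_sub hu K (2 * r - 1)) r s).const_mul_left _
  have h2 := h1.sub (isBigO_interface_sub hu K (2 * r - 1))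
  rw [show 2 * r - 1 + 1 = 2 * r by omega] at h2
  refine h2.congr' ?_ EventuallyEq.rfl
  filter_upwards [eventually_mesh_basic xc K one_pos] with p ⟨h0, _⟩
  have hdeg : (taylorPrim u xc (2 * r - 1)).natDegree ≤ 2 * r :=
    (natDegree_taylorPrim_le _ _ _).trans (by omega)
  have h3 := linRecon_polyAvg_sub hr ((natDegree_meshPoly_le _ p.1 (p.2.2 - xc)).trans hdeg)
  rw [coeff_meshPoly hdeg, ← meshTaylor] at h3
  have h4 : linRecon r (meshData u p)
      = linRecon r (meshData u p - polyAvg (meshTaylor u xc (2 * r - 1) p))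
        + linRecon r (polyAvg (meshTaylor u xc (2 * r - 1) p)) := by
    rw [← linRecon_add, sub_add_cancel]
  have h5 : 1 / p.1 * (p.1 ^ (2 * r) * (taylorPrim u xc (2 * r - 1)).coeff (2 * r))
      = (taylorPrim u xc (2 * r - 1)).coeff (2 * r) * p.1 ^ (2 * r - 1) := by
    obtain ⟨q, hq⟩ : ∃ q, 2 * r = q + 1 := ⟨2 * r - 1, by omega⟩
    rw [hq, Nat.add_sub_cancel, pow_succ]
    field_simp
  rw [h5] at h3
  rw [h4, ← meshTaylor]
  linear_combination -h3

/-! ### Error of the nonlinear reconstruction -/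

lemma isBigO_subRecon_sub {u : ℝ → ℝ} {xc : ℝ} (hu : ContDiffAt ℝ ∞ u xc) {r : ℕ}
    (hr : 1 ≤ r) (K : ℝ) (s : ℕ) :
    (fun p => subRecon r s (meshData u p) - u (p.2.2 + p.1 / 2))
      =O[meshFilter xc K] fun p => p.1 ^ r := by
  have h1 := (isBigO_subRecon (isBigO_meshData_sub hu K (r - 1)) r s).sub
    (isBigO_interface_sub hu K (r - 1))
  rw [show r - 1 + 1 = r by omega] at h1
  refine h1.congr_left fun p => ?_
  have h2 : subRecon r s (polyAvg (meshTaylor u xc (r - 1) p))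
      = (derivative (meshTaylor u xc (r - 1) p)).eval (1 / 2) := by
    rw [subRecon, reconPoly_polyAvg_of_natDegree_le _ _ _
      ((natDegree_meshTaylor_le u xc (r - 1) p).trans (by omega))]
  have h3 : subRecon r s (meshData u p)
      = subRecon r s (meshData u p - polyAvg (meshTaylor u xc (r - 1) p))
        + subRecon r s (polyAvg (meshTaylor u xc (r - 1) p)) := by
    rw [← subRecon_add, sub_add_cancel]
  rw [h3, h2, ← meshTaylor]
  ring

lemma exists_isBigO_recon_sub {u : ℝ → ℝ} {xc : ℝ} (hu : ContDiffAt ℝ ∞ u xc) {r m : ℕ}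
    (hr : 2 ≤ r) (hcp : IsCriticalPointOfOrder u xc m) (hm : m ≤ r - 1) (n : ℕ) :
    ∃ A : ℝ, ∀ K : ℝ,
    (fun p => recon r n p.2.1 (meshData u p) - u (p.2.2 + p.1 / 2) - A * p.1 ^ (2 * r - 1))
      =O[meshFilter xc K] fun p => p.1 ^ min (2 * r) (r + 3 ^ n * (r - 1 - m)) := by
  obtain ⟨A, hA⟩ := exists_isBigO_linRecon_sub hu (by omega : 1 ≤ r)
  refine ⟨A, fun K => ?_⟩
  have h1 : (fun p => ∑ s ∈ Finset.range r, (weightM r p.2.1 (meshData u p) n s - optWeight r s)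
      * (subRecon r s (meshData u p) - u (p.2.2 + p.1 / 2)))
      =O[meshFilter xc K] fun p => p.1 ^ (r + 3 ^ n * (r - 1 - m)) := by
    refine IsBigO.fun_sum fun s hs => ?_
    refine ((isBigO_weightM_meshData hu hr hcp hm K n (Finset.mem_range.1 hs)).mul
      (isBigO_subRecon_sub hu (by omega) K s)).congr_right fun p => ?_
    rw [← pow_add, add_comm]
  refine ((h1.trans (isBigO_mesh_pow xc K (min_le_right _ _))).add
    ((hA K).trans (isBigO_mesh_pow xc K (min_le_left _ _)))).congr' ?_ EventuallyEq.rfl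
  filter_upwards [eventually_mesh_basic xc K one_pos] with p ⟨_, _, hε, _⟩
  -- Since `∑ (ω_s - d_s) = 0`, the exact value may be subtracted from each substencil value, which
  -- gains the factor `h^r`.
  have e1 := sum_weightM hr hε (meshData u p) n
  have e2 := sum_optWeight (by omega : 1 ≤ r)
  rw [recon, linRecon]
  simp only [mul_sub, sub_mul, Finset.sum_sub_distrib, ← Finset.sum_mul, e1, e2]
  ring

/-! ### Reflection -/

lemma cellAverage_reflect (u : ℝ → ℝ) (xc h y : ℝ) :
    cellAverage (fun x => u (2 * xc - x)) h y = cellAverage u h (2 * xc - y) := by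
  rw [cellAverage, cellAverage, intervalIntegral.integral_comp_sub_left u (2 * xc)]
  congr 2 <;> ring

lemma IsCriticalPointOfOrder.reflect {u : ℝ → ℝ} {xc : ℝ} {m : ℕ}
    (h : IsCriticalPointOfOrder u xc m) :
    IsCriticalPointOfOrder (fun x => u (2 * xc - x)) xc m := by
  have e : ∀ k, iteratedDeriv k (fun x => u (2 * xc - x)) xc = (-1) ^ k * iteratedDeriv k u xc := by
    intro k
    rw [iteratedDeriv_comp_const_sub]
    simp only [smul_eq_mul]
    rw [show 2 * xc - xc = xc by ring]
  refine ⟨fun k h1 h2 => by rw [e, h.1 k h1 h2, mul_zero], ?_⟩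
  rw [e]
  exact mul_ne_zero (by simp) h.2

lemma contDiffAt_reflect {u : ℝ → ℝ} {xc : ℝ} (hu : ContDiffAt ℝ ∞ u xc) :
    ContDiffAt ℝ ∞ (fun x => u (2 * xc - x)) xc := by
  refine ContDiffAt.comp (g := u) (f := fun x => 2 * xc - x) xc ?_ (by fun_prop)
  rwa [show 2 * xc - xc = xc by ring]

/-- Neighbouring cells also stay within a fixed multiple of `h` of `xc`, so the estimates at a right
interface carry over to the left one. -/
lemma tendsto_mesh_translate (xc K c : ℝ) :
    Tendsto (fun p : ℝ × ℝ × ℝ => (p.1, p.2.1, p.2.2 + c * p.1)) (meshFilter xc K)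
      (meshFilter xc (K + |c|)) := by
  rw [tendsto_iff_eventually]
  intro P hP
  obtain ⟨h₀, h0, H⟩ := eventually_meshFilter.1 hP
  refine eventually_meshFilter.2 ⟨h₀, h0, fun h h1 h2 ε hε x hx => H h h1 h2 ε hε _ ?_⟩
  rw [add_sub_right_comm, add_mul]
  refine (abs_add_le _ _).trans (add_le_add hx ?_)
  rw [abs_mul, abs_of_pos h1]

lemma tendsto_mesh_reflect (xc K : ℝ) :
    Tendsto (fun p : ℝ × ℝ × ℝ => (p.1, p.2.1, 2 * xc - p.2.2)) (meshFilter xc K)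
      (meshFilter xc K) := by
  rw [tendsto_iff_eventually]
  intro P hP
  obtain ⟨h₀, h0, H⟩ := eventually_meshFilter.1 hP
  refine eventually_meshFilter.2 ⟨h₀, h0, fun h h1 h2 ε hε x hx => H h h1 h2 ε hε _ ?_⟩
  rwa [show 2 * xc - x - xc = -(x - xc) by ring, abs_neg]

/-! ### Flux differences -/

section Flux

variable {α : Type*} {l : Filter α} {f : ℝ → ℝ} {c : ℝ}

lemma isBigO_comp_sub (hf : ContDiffAt ℝ ∞ f c) {a b : α → ℝ} (ha : Tendsto a l (𝓝 c))
    (hb : Tendsto b l (𝓝 c)) : (fun p => f (a p) - f (b p)) =O[l] fun p => a p - b p := by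
  have h := (hf.hasStrictFDerivAt (by simp)).isBigO_sub
  exact h.comp_tendsto (ha.prodMk_nhds hb)

/-- Mean value inequality for `t ↦ f (t + e) - f t`, whose derivative is at most `L |e|` when `f'`
is `L`-Lipschitz. -/
lemma isBigO_second_difference (hf : ContDiffAt ℝ ∞ f c) {a b e : α → ℝ}
    (ha : Tendsto a l (𝓝 c)) (hb : Tendsto b l (𝓝 c)) (he : Tendsto e l (𝓝 0)) :
    (fun p => (f (a p + e p) - f (a p)) - (f (b p + e p) - f (b p)))
      =O[l] fun p => e p * (a p - b p) := by
  have hf' : ContDiffAt ℝ 1 (deriv f) c := by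
    refine hf.derivWithin ?_
    rw [one_add_one_eq_two]
    exact WithTop.coe_le_coe.2 (le_top : (2 : ℕ∞) ≤ ⊤)
  obtain ⟨L, S, hS, hL⟩ := hf'.exists_lipschitzOnWith
  have hdiff : ∀ᶠ x in 𝓝 c, DifferentiableAt ℝ f x :=
    ((hf.of_le (m := 1) (by exact_mod_cast le_top)).eventually (by simp)).mono
      fun x hx => hx.differentiableAt (by simp)
  obtain ⟨δ, hδ, hball⟩ := Metric.eventually_nhds_iff_ball.1 (hdiff.and hS)
  have ev : ∀ {y : α → ℝ}, Tendsto y l (𝓝 c) → ∀ᶠ p in l, y p ∈ Metric.ball c (δ / 2) :=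
    fun hy => hy.eventually (Metric.ball_mem_nhds c (half_pos hδ))
  have eve : ∀ᶠ p in l, e p ∈ Metric.ball 0 (δ / 2) :=
    he.eventually (Metric.ball_mem_nhds 0 (half_pos hδ))
  refine IsBigO.of_bound L ?_
  filter_upwards [ev ha, ev hb, eve] with p h1 h2 h3
  have hin : ∀ t ∈ Metric.ball c (δ / 2), t ∈ Metric.ball c δ ∧ t + e p ∈ Metric.ball c δ := by
    intro t ht
    simp only [Metric.mem_ball, Real.dist_eq, sub_zero] at ht h3 ⊢
    refine ⟨by linarith, ?_⟩
    rw [add_sub_right_comm]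
    exact (abs_add_le _ _).trans_lt (by linarith)
  have hder : ∀ t ∈ Metric.ball c (δ / 2), HasDerivWithinAt (fun t => f (t + e p) - f t)
      (deriv f (t + e p) - deriv f t) (Metric.ball c (δ / 2)) t := by
    intro t ht
    have h4 := ((hball _ (hin t ht).2).1.hasDerivAt.comp_add_const t (e p)).sub
      (hball _ (hin t ht).1).1.hasDerivAt
    exact h4.hasDerivWithinAt
  have hbd : ∀ t ∈ Metric.ball c (δ / 2), ‖deriv f (t + e p) - deriv f t‖ ≤ L * |e p| := by
    intro t ht
    have := hL.dist_le_mul _ (hball _ (hin t ht).2).2 _ (hball _ (hin t ht).1).2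
    simpa [Real.dist_eq] using this
  have := (convex_ball c (δ / 2)).norm_image_sub_le_of_norm_hasDerivWithin_le hder hbd h2 h1
  simpa [abs_mul, mul_assoc] using this

/-- Both arguments carry the same perturbation `e` up to `H`. Local Lipschitz continuity removes the
`H` part, and the second difference bounds what the common `e` contributes. -/
lemma isBigO_flux_difference (hf : ContDiffAt ℝ ∞ f c) {a b a' b' e H : α → ℝ}
    (ha : Tendsto a l (𝓝 c)) (hb : Tendsto b l (𝓝 c)) (he : Tendsto e l (𝓝 0))
    (hH : Tendsto H l (𝓝 0)) (ha' : (fun p => a' p - a p - e p) =O[l] H)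
    (hb' : (fun p => b' p - b p - e p) =O[l] H)
    (hab : (fun p => e p * (a p - b p)) =O[l] H) :
    (fun p => (f (a' p) - f (a p)) - (f (b' p) - f (b p))) =O[l] H := by
  have key : ∀ {y y' : α → ℝ}, Tendsto y l (𝓝 c) → (fun p => y' p - y p - e p) =O[l] H →
      (fun p => f (y' p) - f (y p + e p)) =O[l] H := by
    intro y y' hy hy'
    have h1 : Tendsto (fun p => y p + e p) l (𝓝 c) := by simpa using hy.add he
    have h2 : Tendsto y' l (𝓝 c) := by
      have := (hy'.trans_tendsto hH).add h1
      simpa using this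
    refine (isBigO_comp_sub hf h2 h1).trans (hy'.congr_left fun p => ?_)
    ring
  refine (((key ha ha').sub (key hb hb')).add
    ((isBigO_second_difference hf ha hb he).trans hab)).congr_left fun p => ?_
  ring

end Flux

/-! ### Rates -/

/-- The floor condition is equivalent to `r ≤ 3^n (r - 1 - m)`, that is, to the minimum being `2r`.
The added 1 is the order lost in dividing the flux difference by `h`. -/
lemma convRate_add_one {r n m : ℕ} (hr : 2 ≤ r) (hm : m ≤ r - 1) :
    convRate r n m + 1 = (min (2 * r) (r + 3 ^ n * (r - 1 - m)) : ℕ) := by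
  obtain ⟨q, rfl⟩ : ∃ q, r = m + 1 + q := ⟨r - 1 - m, by omega⟩
  have hq : m + 1 + q - 1 - m = q := by omega
  have h3 : (0 : ℝ) < 3 ^ n := by positivity
  have hiff : (m : ℤ) ≤ ⌊((3 : ℝ) ^ n - 1) / 3 ^ n * ((m + 1 + q : ℕ) : ℝ) - 1⌋
      ↔ m + 1 + q ≤ 3 ^ n * q := by
    rw [Int.le_floor, div_mul_eq_mul_div, le_sub_iff_add_le, le_div_iff₀ h3,
      ← Nat.cast_le (α := ℝ)]
    push_cast
    constructor <;> intro h <;> linarith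
  rw [convRate, hq]
  split_ifs with h
  · rw [hiff] at h
    rw [min_eq_left (by omega)]
    push_cast
    ring
  · rw [hiff] at h
    rw [min_eq_right (by omega)]
    push_cast
    ring

/-! ### The scheme near a critical point -/

lemma meshAverages_add (u : ℝ → ℝ) (h ε x₀ : ℝ) (j : ℤ) :
    (fun k => meshAverages u h x₀ (j + k)) = meshData u (h, ε, x₀ + j * h) := by
  funext k
  simp only [meshAverages, meshData]
  push_cast
  ring_nf

lemma meshAverages_reflect (u : ℝ → ℝ) (xc h ε x₀ : ℝ) (j : ℤ) :
    (fun k => meshAverages u h x₀ (j - k))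
      = meshData (fun x => u (2 * xc - x)) (h, ε, 2 * xc - (x₀ + j * h)) := by
  funext k
  simp only [meshAverages, meshData, cellAverage_reflect]
  push_cast
  ring_nf

/-- The flux difference of the scheme minus the exact one on the cell with centre `p.2.2`, in
terms of reconstructions from mesh data. -/
noncomputable def fluxError (r n : ℕ) (f u : ℝ → ℝ) (a xc : ℝ) (p : ℝ × ℝ × ℝ) : ℝ :=
  laxFriedrichs f a (recon r n p.2.1 (meshData u p))
      (recon r n p.2.1 (meshData (fun x => u (2 * xc - x)) (p.1, p.2.1, 2 * xc - (p.2.2 + p.1))))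
    - laxFriedrichs f a (recon r n p.2.1 (meshData u (p.1, p.2.1, p.2.2 - p.1)))
      (recon r n p.2.1 (meshData (fun x => u (2 * xc - x)) (p.1, p.2.1, 2 * xc - p.2.2)))
    - (f (u (p.2.2 + p.1 / 2)) - f (u (p.2.2 - p.1 / 2)))

lemma schemeOp_sub_exactOp (r n : ℕ) (f u : ℝ → ℝ) (a xc h ε x₀ : ℝ) (j : ℤ) :
    schemeOp r n ε f a h (meshAverages u h x₀) j - exactOp f u h (x₀ + j * h)
      = -(1 / h) * fluxError r n f u a xc (h, ε, x₀ + j * h) := by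
  simp only [schemeOp, exactOp, numFlux, uMinus, uPlus, fluxError, meshAverages_add u h ε,
    meshAverages_reflect u xc h ε, sub_add_cancel]
  have e1 : x₀ + ((j - 1 : ℤ) : ℝ) * h = x₀ + j * h - h := by push_cast; ring
  have e2 : x₀ + ((j + 1 : ℤ) : ℝ) * h = x₀ + j * h + h := by push_cast; ring
  rw [e1, e2]
  ring

lemma isBigO_fluxError {u : ℝ → ℝ} {xc : ℝ} (hu : ContDiffAt ℝ ∞ u xc) {r m : ℕ}
    (hr : 2 ≤ r) (hcp : IsCriticalPointOfOrder u xc m) (hm : m ≤ r - 1) (n : ℕ) (K : ℝ)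
    {f : ℝ → ℝ} (hf : ContDiffAt ℝ ∞ f (u xc)) (a : ℝ) :
    fluxError r n f u a xc =O[meshFilter xc K]
      fun p => p.1 ^ min (2 * r) (r + 3 ^ n * (r - 1 - m)) := by
  obtain ⟨A, hA⟩ := exists_isBigO_recon_sub hu hr hcp hm n
  obtain ⟨A', hA'⟩ := exists_isBigO_recon_sub (contDiffAt_reflect hu) hr hcp.reflect hm n
  set q := min (2 * r) (r + 3 ^ n * (r - 1 - m)) with hq
  have hq0 : q ≠ 0 := by omega
  have hH : Tendsto (fun p : ℝ × ℝ × ℝ => p.1 ^ q) (meshFilter xc K) (𝓝 0) := by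
    simpa [hq0] using (tendsto_mesh_width xc K).pow q
  have hR : Tendsto (fun p : ℝ × ℝ × ℝ => u (p.2.2 + p.1 / 2)) (meshFilter xc K) (𝓝 (u xc)) := by
    refine (hu.continuousAt.tendsto.comp (tendsto_mesh_shift xc K (1 / 2))).congr fun p => ?_
    simp only [Function.comp_apply]
    ring_nf
  have hL : Tendsto (fun p : ℝ × ℝ × ℝ => u (p.2.2 - p.1 / 2)) (meshFilter xc K) (𝓝 (u xc)) := by
    refine (hu.continuousAt.tendsto.comp (tendsto_mesh_shift xc K (-1 / 2))).congr fun p => ?_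
    simp only [Function.comp_apply]
    ring_nf
  have hRL : (fun p : ℝ × ℝ × ℝ => u (p.2.2 + p.1 / 2) - u (p.2.2 - p.1 / 2))
      =O[meshFilter xc K] fun p => p.1 := by
    refine (isBigO_comp_sub hu (tendsto_mesh_shift xc K (1 / 2))
      (tendsto_mesh_shift xc K (-1 / 2))).congr (fun p => ?_) fun p => ?_ <;> ring_nf
  have hE : ∀ c : ℝ, Tendsto (fun p : ℝ × ℝ × ℝ => c * p.1 ^ (2 * r - 1)) (meshFilter xc K)
      (𝓝 0) := by
    intro c
    simpa [show 2 * r - 1 ≠ 0 by omega] using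
      ((tendsto_mesh_width xc K).pow (2 * r - 1)).const_mul c
  have hEO : ∀ c : ℝ, (fun p : ℝ × ℝ × ℝ => c * p.1 ^ (2 * r - 1)
      * (u (p.2.2 + p.1 / 2) - u (p.2.2 - p.1 / 2))) =O[meshFilter xc K] fun p => p.1 ^ q := by
    intro c
    refine ((((isBigO_refl _ _).const_mul_left c).mul hRL).trans
      ((isBigO_mesh_pow xc K (min_le_left _ _ : q ≤ 2 * r)).congr_left fun p => ?_))
    rw [← pow_succ, show 2 * r - 1 + 1 = 2 * r by omega]
  have m1 := hA K
  have m0 : (fun p : ℝ × ℝ × ℝ => recon r n p.2.1 (meshData u (p.1, p.2.1, p.2.2 - p.1))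
      - u (p.2.2 - p.1 / 2) - A * p.1 ^ (2 * r - 1)) =O[meshFilter xc K] fun p => p.1 ^ q := by
    refine ((hA _).comp_tendsto (tendsto_mesh_translate xc K (-1))).congr
      (fun p => ?_) fun p => rfl
    simp only [Function.comp_apply]
    rw [show p.2.2 + -1 * p.1 = p.2.2 - p.1 by ring,
      show p.2.2 - p.1 + p.1 / 2 = p.2.2 - p.1 / 2 by ring]
  have q0 : (fun p : ℝ × ℝ × ℝ => recon r n p.2.1 (meshData (fun x => u (2 * xc - x))
      (p.1, p.2.1, 2 * xc - p.2.2)) - u (p.2.2 - p.1 / 2) - A' * p.1 ^ (2 * r - 1))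
      =O[meshFilter xc K] fun p => p.1 ^ q := by
    refine ((hA' _).comp_tendsto (tendsto_mesh_reflect xc K)).congr (fun p => ?_) fun p => rfl
    simp only [Function.comp_apply]
    rw [show 2 * xc - (2 * xc - p.2.2 + p.1 / 2) = p.2.2 - p.1 / 2 by ring]
  have q1 : (fun p : ℝ × ℝ × ℝ => recon r n p.2.1 (meshData (fun x => u (2 * xc - x))
      (p.1, p.2.1, 2 * xc - (p.2.2 + p.1))) - u (p.2.2 + p.1 / 2) - A' * p.1 ^ (2 * r - 1))
      =O[meshFilter xc K] fun p => p.1 ^ q := by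
    refine ((hA' _).comp_tendsto ((tendsto_mesh_reflect xc _).comp
      (tendsto_mesh_translate xc K 1))).congr (fun p => ?_) fun p => rfl
    simp only [Function.comp_apply, one_mul]
    rw [show 2 * xc - (2 * xc - (p.2.2 + p.1) + p.1 / 2) = p.2.2 + p.1 / 2 by ring]
  have f1 := isBigO_flux_difference hf hR hL (hE A) hH m1 m0 (hEO A)
  have f2 := isBigO_flux_difference hf hR hL (hE A') hH q1 q0 (hEO A')
  -- In the viscosity term `A` cancels within `m1 - m0` and `A'` within `q1 - q0`, so the two
  -- constants need not be related.
  have f3 := ((q1.sub q0).sub (m1.sub m0)).const_mul_left a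
  refine (((f1.add f2).sub f3).const_mul_left (1 / 2)).congr_left fun p => ?_
  simp only [fluxError, laxFriedrichs]
  ring

end WENO

theorem mainTheorem3 (r : ℕ) (hr2 : 2 ≤ r) (hr9 : r ≤ 9) (n ncp : ℕ) (hncp : ncp ≤ r - 1)
    (u : ℝ → ℝ) (xc : ℝ) (hu : ContDiffAt ℝ ∞ u xc)
    (hcp : WENO.IsCriticalPointOfOrder u xc ncp) (K : ℝ) :
    (∃ C > 0, ∃ h₀ > 0, ∀ h : ℝ, 0 < h → h < h₀ → ∀ ε : ℝ, 0 < ε →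
      ∀ (x₀ : ℝ) (j : ℤ), |x₀ + j * h - xc| ≤ K * h → ∀ s < r,
        |WENO.weightMinus r n ε (WENO.meshAverages u h x₀) j s - WENO.optWeight r s|
          ≤ C * h ^ (3 ^ n * ((r : ℤ) - 1 - (ncp : ℤ)))) ∧
    (∀ (f : ℝ → ℝ) (a : ℝ), ContDiffAt ℝ ∞ f (u xc) →
      ∃ C > 0, ∃ h₀ > 0, ∀ h : ℝ, 0 < h → h < h₀ → ∀ ε : ℝ, 0 < ε →
      ∀ (x₀ : ℝ) (j : ℤ), |x₀ + j * h - xc| ≤ K * h →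
        |WENO.schemeOp r n ε f a h (WENO.meshAverages u h x₀) j
            - WENO.exactOp f u h (x₀ + j * h)|
          ≤ C * h ^ WENO.convRate r n ncp) := by
  constructor
  -- Summing over `s` yields one pair `C`, `h₀` valid for all weights.
  · have hO : (fun p => ∑ s ∈ Finset.range r,
        |WENO.weightM r p.2.1 (WENO.meshData u p) n s - WENO.optWeight r s|)
        =O[WENO.meshFilter xc K] fun p => p.1 ^ (3 ^ n * (r - 1 - ncp)) :=
      IsBigO.fun_sum fun s hs => (WENO.isBigO_weightM_meshData hu hr2 hcp hncp K n
        (Finset.mem_range.1 hs)).abs_left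
    obtain ⟨C, hC, h₀, h0, H⟩ := WENO.bound_of_isBigO_mesh hO
    refine ⟨C, hC, h₀, h0, fun h h1 h2 ε hε x₀ j hx s hs => ?_⟩
    have hb := (le_abs_self _).trans (H h h1 h2 ε hε _ hx)
    have hexp : (3 : ℤ) ^ n * ((r : ℤ) - 1 - (ncp : ℤ)) = (3 ^ n * (r - 1 - ncp) : ℕ) := by
      rw [Nat.cast_mul, Nat.sub_sub, Nat.cast_sub (by omega)]
      push_cast
      ring
    rw [hexp, zpow_natCast, WENO.weightMinus, WENO.meshAverages_add u h ε]
    rw [abs_of_pos (pow_pos h1 _)] at hb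
    exact (Finset.single_le_sum (f := fun s => |WENO.weightM r ε
      (WENO.meshData u (h, ε, x₀ + j * h)) n s - WENO.optWeight r s|)
      (fun _ _ => abs_nonneg _) (Finset.mem_range.2 hs)).trans hb
  · intro f a hf
    obtain ⟨C, hC, h₀, h0, H⟩ := WENO.bound_of_isBigO_mesh
      (WENO.isBigO_fluxError hu hr2 hcp hncp n K hf a)
    refine ⟨C, hC, h₀, h0, fun h h1 h2 ε hε x₀ j hx => ?_⟩
    have hb := H h h1 h2 ε hε _ hx
    rw [abs_of_pos (pow_pos h1 _), ← zpow_natCast, ← WENO.convRate_add_one hr2 hncp,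
      zpow_add_one₀ h1.ne'] at hb
    rw [WENO.schemeOp_sub_exactOp r n f u a xc h ε, abs_mul, abs_neg,
      abs_of_pos (one_div_pos.2 h1)]
    calc 1 / h * |WENO.fluxError r n f u a xc (h, ε, x₀ + j * h)|
        ≤ 1 / h * (C * (h ^ WENO.convRate r n ncp * h)) := by gcongr
      _ = C * h ^ WENO.convRate r n ncp := by field_simp
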